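/- Consider the Helmholtz equation $(\gamma P_x)_x+(\gamma P_y)_y+(\gamma P_z)_z+\gamma\kappa^2P=0$ for $-H\le z\le 0$, with $P=0$ at $z=0$, $P_z=0$ at $z=-H$, and with $P$ and $\gamma(P_z-h_xP_x-h_yP_y)$ continuous across one interface $z=h$. Let $\epsilon>0$, $X=\epsilon x$, $Y=\epsilon^{1/2}y$, and $$\kappa^2=n_0^2(X,z)+\epsilon\nu(X,Y,z),\quad \gamma=\gamma_0(X,z)+\epsilon\gamma_1(X,Y,z),\quad h=h_0(X)+\epsilon h_1(X,Y),$$ where $\gamma_0>0$, $-H<h_0<0$, $\nu$ is complex valued, the other parameters are real, $X$ ranges over an open set, and the parameters are smooth on each side of the interface up to it (continuity in $z$ suffices for $n_0$ and $\nu$). For $f$ piecewise smooth, $f_+$ and $f_-$ denote its limits at $z=h_0$ from above and from below. Let $(k_j^2,\phi_j)$, $j=M,\dots,N$, be eigenpairs, smooth in $X$, with pairwise distinct $k_j>0$ and real $\phi_j$, of $$(\gamma_0\phi_z)_z+\gamma_0n_0^2\phi-\gamma_0k^2\phi=0,\quad \phi|_{z=0}=0,\quad \phi_z|_{z=-H}=0,\quad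 \phi \text{ and } \gamma_0\phi_z \text{ continuous at } z=h_0,\quad \int_{-H}^0\gamma_0\phi^2\,dz=1 .$$ Let $\theta_{j,X}=k_j$, let the resonance condition $|k_l-k_j|<\epsilon$ hold for $M\le j,l\le N$, and take the ansatz $$P=\sum_{j=M}^N\bigl(u_0^{(j)}+\epsilon u_1^{(j)}+\dots\bigr)\exp\Bigl(\frac{\mathrm i}{\epsilon}\theta_j\Bigr),\qquad u_0^{(j)}=A_j(X,Y)\phi_j(X,z).$$ The problem at $O(\epsilon)$ is the boundary value problem in $z$ for $(u_1^{(j)})_{j=M}^N$, with $X,Y$ as parameters, formed by the coefficients of $\epsilon$ (the phase factors being kept as factors): of the Helmholtz equation, summed over $j$, and, for each $j$, of the boundary conditions and of the interface conditions Taylor expanded at $z=h_0$. Put $B_{jl}=\int_{-H}^0\gamma_0u_1^{(j)}\phi_l\,dz$ and $C_{jl}=\int_{-H}^0\gamma_0\phi_{j,X}\phi_l\,dz$. In this problem the components $B_{jl}\phi_l$ of $u_1^{(j)}$, $M\le j,l\le N$, enter the left-hand side of the Helmholtz equation through the resonant terms $(k_l^2-k_j^2)B_{jl}\gamma_0\phi_l\exp(\mathrm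 i\theta_j/\epsilon)$. With the resonant terms omitted, the problem at $O(\epsilon)$ is solvable if and only if, for $l=M,\dots,N$, $$2\mathrm i k_lA_{l,X}+\mathrm i k_{l,X}A_l+A_{l,YY}+\alpha_{ll}A_l+\sum_{j=M,\,j\ne l}^N\alpha_{lj}A_j\exp(\theta_{lj})=0,\qquad \theta_{lj}=\frac{\mathrm i}{\epsilon}(\theta_j-\theta_l),$$ where $$\begin{aligned}\alpha_{lj}={}&\int_{-H}^0\gamma_0\nu\phi_j\phi_l\,dz+\int_{-H}^0\gamma_1(n_0^2-k_j^2)\phi_j\phi_l\,dz-\int_{-H}^0\gamma_1\phi_{jz}\phi_{lz}\,dz-\mathrm i k_j(C_{lj}-C_{jl})\\&+\Bigl\{h_1\phi_l\bigl[((\gamma_0\phi_{jz})_z)_+-((\gamma_0\phi_{jz})_z)_-\bigr]-h_1\gamma_0^2\phi_{jz}\phi_{lz}\Bigl[\Bigl(\frac1{\gamma_0}\Bigr)_+-\Bigl(\frac1{\gamma_0}\Bigr)_-\Bigr]\Bigr\}\Big|_{z=h_0}.\end{aligned}$$ Moreover, for every solution of the full problem at $O(\epsilon)$ the left-hand side of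 the $l$-th equation equals $-\sum_{j\ne l}(k_l^2-k_j^2)B_{jl}\exp(\theta_{lj})$, and is therefore at most $\epsilon\sum_{j\ne l}(k_l+k_j)|B_{jl}|$ in absolute value. -/

import Mathlib

/-! Slow variables `X = ε x`, `Y = ε^{1/2} y`, depth `z ∈ [-H, 0]`, one interface `z = h`. -/

/-- The two sides of the interface: `above` is `h₀ < z < 0`, `below` is `-H < z < h₀`.
A piecewise smooth function is given by its two smooth pieces, indexed by the side; the one-sided
limits `f₊`, `f₋` at the interface are the values there of the pieces `above`, `below`. -/
inductive Side where
  | above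
  | below

/-- Complex fields depending on `(X, Y, z)`. -/
abbrev Fld : Type := ℝ → ℝ → ℝ → ℂ

/-- Formal expansions `f₀ + ε f₁ + ε² f₂ + …` with coefficients depending on `(X, Y, z)`. -/
abbrev Expansion : Type := PowerSeries Fld

/-- The parameters of the waveguide: `h = h₀ + ε h₁`, `γ = γ₀ + ε γ₁`, `κ² = n₀² + ε ν`. -/
structure Waveguide where
  /-- total depth -/
  H : ℝ
  h₀ : ℝ → ℝ
  h₁ : ℝ → ℝ → ℝ
  γ₀ : Side → ℝ → ℝ → ℝ
  γ₁ : Side → ℝ → ℝ → ℝ → ℝ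
  n₀ : Side → ℝ → ℝ → ℝ
  ν : Side → ℝ → ℝ → ℝ → ℂ

noncomputable section

/-! ### Formal multiscale calculus -/

/-- Partial derivatives of a field. -/
def dX (f : Fld) : Fld := fun X Y z => deriv (fun t => f t Y z) X

def dY (f : Fld) : Fld := fun X Y z => deriv (fun t => f X t z) Y

def dZ (f : Fld) : Fld := fun X Y z => deriv (fun t => f X Y t) z

/-- Coefficientwise action of an operator on an expansion. -/
def termwise (D : Fld → Fld) (f : Expansion) : Expansion :=
  PowerSeries.mk fun n => D (PowerSeries.coeff n f)

/-- `∂/∂x` on an amplitude multiplied by the phase factor `exp (i θ(X) / ε)`: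
`∂ₓ (u exp (i θ / ε)) = (i θ_X u + ε u_X) exp (i θ / ε)`. -/
def phaseDx (θ : ℝ → ℝ) (u : Expansion) : Expansion :=
  PowerSeries.C (fun X _ _ => Complex.I * ((deriv θ X : ℝ) : ℂ) : Fld) * u
    + PowerSeries.X * termwise dX u

/-- The Helmholtz operator `(γ P_x)_x + (γ P_y)_y + (γ P_z)_z + γ κ² P` applied to
`P = u exp (i θ / ε)`, the factor `exp (i θ / ε)` being divided out. Since `∂_y = ε^{1/2} ∂_Y`,
the second term is `ε (γ u_Y)_Y`. -/
def helmholtz (γ κsq : Expansion) (θ : ℝ → ℝ) (u : Expansion) : Expansion :=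
  phaseDx θ (γ * phaseDx θ u) + PowerSeries.X * termwise dY (γ * termwise dY u)
    + termwise dZ (γ * termwise dZ u) + γ * κsq * u

namespace Waveguide

variable (W : Waveguide)

/-- `γ = γ₀ + ε γ₁` on the given side. -/
def γ (s : Side) : Expansion :=
  PowerSeries.C (fun X _ z => (W.γ₀ s X z : ℂ) : Fld)
    + PowerSeries.X * PowerSeries.C (fun X Y z => (W.γ₁ s X Y z : ℂ) : Fld)

/-- `κ² = n₀² + ε ν` on the given side. -/
def κsq (s : Side) : Expansion :=
  PowerSeries.C (fun X _ z => ((W.n₀ s X z) ^ 2 : ℂ) : Fld)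
    + PowerSeries.X * PowerSeries.C (W.ν s : Fld)

/-- `h = h₀ + ε h₁`. -/
def h : Expansion :=
  PowerSeries.C (fun X _ _ => (W.h₀ X : ℂ) : Fld)
    + PowerSeries.X * PowerSeries.C (fun X Y _ => (W.h₁ X Y : ℂ) : Fld)

/-- The Taylor expansion in `ε` of the value of `f₀ + ε f₁ + …` at `z = h₀ + ε h₁`. -/
def trace (f : Expansion) : PowerSeries (ℝ → ℝ → ℂ) :=
  PowerSeries.mk fun n X Y => ∑ m ∈ Finset.range (n + 1),
    (W.h₁ X Y : ℂ) ^ m / (m.factorial : ℂ)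
      * iteratedDeriv m (fun z => PowerSeries.coeff (n - m) f X Y z) (W.h₀ X)

/-- `γ (P_z - h_x P_x - h_y P_y)` for `P = u exp (i θ / ε)`, the factor `exp (i θ / ε)` being
divided out; `h_x = ε h_X` and `h_y P_y = ε h_Y u_Y exp (i θ / ε)`. -/
def flux (s : Side) (θ : ℝ → ℝ) (u : Expansion) : Expansion :=
  W.γ s * (termwise dZ u - PowerSeries.X * termwise dX W.h * phaseDx θ u
    - PowerSeries.X * termwise dY W.h * termwise dY u)

/-- The closed layer on the given side of `z = h₀(X)`. -/
def layer (s : Side) (X : ℝ) : Set ℝ :=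
  match s with
  | .above => Set.Icc (W.h₀ X) 0
  | .below => Set.Icc (-W.H) (W.h₀ X)

/-- The open layer on the given side of `z = h₀(X)`. -/
def openLayer (s : Side) (X : ℝ) : Set ℝ :=
  match s with
  | .above => Set.Ioo (W.h₀ X) 0
  | .below => Set.Ioo (-W.H) (W.h₀ X)

/-- `∫_{-H}^0 f dz` for a piecewise given function. -/
def depthIntegral (f : Side → ℝ → ℂ) (X : ℝ) : ℂ :=
  (∫ z in (-W.H)..(W.h₀ X), f .below z) + ∫ z in (W.h₀ X)..0, f .above z

/-- `f₊ - f₋` at `z = h₀(X)`. -/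
def jump (f : Side → ℝ → ℂ) (X : ℝ) : ℂ := f .above (W.h₀ X) - f .below (W.h₀ X)

/-- Standing assumptions on the medium for `X ∈ I`. Near a point of a closed layer the piece of that
layer is a function on a full neighbourhood (smoothness up to and slightly across the boundary). -/
structure Regular (I : Set ℝ) : Prop where
  interface : ∀ X ∈ I, -W.H < W.h₀ X ∧ W.h₀ X < 0
  differentiable_h₀ : ∀ X ∈ I, DifferentiableAt ℝ W.h₀ X
  differentiable_h₁ : ∀ X ∈ I, ∀ Y, DifferentiableAt ℝ (fun p : ℝ × ℝ => W.h₁ p.1 p.2) (X, Y)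
  pos_γ₀ : ∀ s, ∀ X ∈ I, ∀ z ∈ W.layer s X, 0 < W.γ₀ s X z
  smooth_γ₀ : ∀ s, ∀ X ∈ I, ∀ z ∈ W.layer s X,
    ContDiffAt ℝ 1 (fun p : ℝ × ℝ => W.γ₀ s p.1 p.2) (X, z)
  smooth_γ₁ : ∀ s, ∀ X ∈ I, ∀ Y, ∀ z ∈ W.layer s X, ContDiffAt ℝ 1 (W.γ₁ s X Y) z
  continuous_n₀ : ∀ s, ∀ X ∈ I, ∀ z ∈ W.layer s X, ContinuousAt (W.n₀ s X) z
  continuous_ν : ∀ s, ∀ X ∈ I, ∀ Y, ∀ z ∈ W.layer s X, ContinuousAt (W.ν s X Y) z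

/-- `(k², φ)` is an eigenpair, `k > 0`, `φ` real and normalized, of the spectral problem
`(γ₀ φ_z)_z + γ₀ n₀² φ - γ₀ k² φ = 0`, `φ(0) = 0`, `φ_z(-H) = 0`, with `φ` and `γ₀ φ_z` continuous
at `z = h₀`, depending smoothly on `X ∈ I`. -/
structure IsMode (I : Set ℝ) (k : ℝ → ℝ) (φ : Side → ℝ → ℝ → ℝ) : Prop where
  pos : ∀ X ∈ I, 0 < k X
  differentiable_k : ∀ X ∈ I, DifferentiableAt ℝ k X
  smooth : ∀ s, ∀ X ∈ I, ∀ z ∈ W.layer s X, ContDiffAt ℝ 2 (fun p : ℝ × ℝ => φ s p.1 p.2) (X, z)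
  spectral : ∀ s, ∀ X ∈ I, ∀ z ∈ W.openLayer s X,
    deriv (fun t => W.γ₀ s X t * deriv (φ s X) t) z + W.γ₀ s X z * (W.n₀ s X z) ^ 2 * φ s X z
      - W.γ₀ s X z * (k X) ^ 2 * φ s X z = 0
  surface : ∀ X ∈ I, φ .above X 0 = 0
  bottom : ∀ X ∈ I, deriv (φ .below X) (-W.H) = 0
  continuous : ∀ X ∈ I, φ .above X (W.h₀ X) = φ .below X (W.h₀ X)
  continuous_flux : ∀ X ∈ I, W.γ₀ .above X (W.h₀ X) * deriv (φ .above X) (W.h₀ X)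
    = W.γ₀ .below X (W.h₀ X) * deriv (φ .below X) (W.h₀ X)
  normalized : ∀ X ∈ I,
    (∫ z in (-W.H)..(W.h₀ X), W.γ₀ .below X z * φ .below X z ^ 2)
      + (∫ z in (W.h₀ X)..0, W.γ₀ .above X z * φ .above X z ^ 2) = 1

/-! ### The problem at order `ε` -/

/-- The problem at order `ε` for the ansatz `P = ∑_{j ∈ J} u⁽ʲ⁾ exp (i θ_j / ε)`,
`u⁽ʲ⁾ = u₀⁽ʲ⁾ + ε u₁⁽ʲ⁾ + …`, on `X ∈ I`, `Y ∈ ℝ`: the coefficients of `ε` in the Helmholtz equation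
(summed over the phases), in the boundary conditions and in the interface conditions on
`z = h₀ + ε h₁`. The field `r` is the right-hand side of the Helmholtz equation at this order:
`r = 0` is the problem proper. -/
structure SolvesOrderOne (I : Set ℝ) (J : Finset ℕ) (ε : ℝ) (θ : ℕ → ℝ → ℝ) (r : Side → Fld)
    (u : ℕ → Side → Expansion) : Prop where
  smooth : ∀ j ∈ J, ∀ s, ∀ X ∈ I, ∀ Y, ∀ z ∈ W.layer s X,
    ContDiffAt ℝ 2 (PowerSeries.coeff 1 (u j s) X Y) z
  equation : ∀ s, ∀ X ∈ I, ∀ Y, ∀ z ∈ W.openLayer s X,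
    ∑ j ∈ J, PowerSeries.coeff 1 (helmholtz (W.γ s) (W.κsq s) (θ j) (u j s)) X Y z
      * Complex.exp (Complex.I / ε * θ j X) = r s X Y z
  surface : ∀ j ∈ J, ∀ X ∈ I, ∀ Y, PowerSeries.coeff 1 (u j .above) X Y 0 = 0
  bottom : ∀ j ∈ J, ∀ X ∈ I, ∀ Y, PowerSeries.coeff 1 (termwise dZ (u j .below)) X Y (-W.H) = 0
  interface : ∀ j ∈ J, ∀ X ∈ I, ∀ Y,
    PowerSeries.coeff 1 (W.trace (u j .above)) X Y
      = PowerSeries.coeff 1 (W.trace (u j .below)) X Y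
  interface_flux : ∀ j ∈ J, ∀ X ∈ I, ∀ Y,
    PowerSeries.coeff 1 (W.trace (W.flux .above (θ j) (u j .above))) X Y
      = PowerSeries.coeff 1 (W.trace (W.flux .below (θ j) (u j .below))) X Y

/-- The leading terms are `u₀⁽ʲ⁾ = A_j(X, Y) φ_j(X, z)`. -/
def HasLeadingTerm (J : Finset ℕ) (φ : ℕ → Side → ℝ → ℝ → ℝ) (A : ℕ → ℝ → ℝ → ℂ)
    (u : ℕ → Side → Expansion) : Prop :=
  ∀ j ∈ J, ∀ s, PowerSeries.coeff 0 (u j s) = fun X Y z => A j X Y * (φ j s X z : ℂ)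

/-- `B_{jl} = ∫ γ₀ u₁⁽ʲ⁾ φ_l dz`. -/
def B (φ : ℕ → Side → ℝ → ℝ → ℝ) (u : ℕ → Side → Expansion) (j l : ℕ) (X Y : ℝ) : ℂ :=
  W.depthIntegral
    (fun s z => (W.γ₀ s X z : ℂ) * PowerSeries.coeff 1 (u j s) X Y z * (φ l s X z : ℂ)) X

/-- The resonant part of the left-hand side of the Helmholtz equation at order `ε`. The operator
`(γ₀ ∂_z)_z + γ₀ n₀² - γ₀ k_j²` maps the component `B_{jl} φ_l` of `u₁⁽ʲ⁾` to
`(k_l² - k_j²) B_{jl} γ₀ φ_l`; here these terms are collected for `j, l ∈ J`. -/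
def resonantPart (J : Finset ℕ) (ε : ℝ) (θ k : ℕ → ℝ → ℝ) (φ : ℕ → Side → ℝ → ℝ → ℝ)
    (u : ℕ → Side → Expansion) : Side → Fld := fun s X Y z =>
  ∑ j ∈ J, (∑ l ∈ J, ((k l X : ℂ) ^ 2 - (k j X : ℂ) ^ 2) * W.B φ u j l X Y
    * (W.γ₀ s X z : ℂ) * (φ l s X z : ℂ)) * Complex.exp (Complex.I / ε * θ j X)

/-! ### The mode parabolic equations -/

/-- `C_{jl} = ∫ γ₀ φ_{jX} φ_l dz`. -/
def C (φ : ℕ → Side → ℝ → ℝ → ℝ) (j l : ℕ) (X : ℝ) : ℂ :=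
  W.depthIntegral
    (fun s z => (W.γ₀ s X z * deriv (fun t => φ j s t z) X * φ l s X z : ℝ)) X

/-- The coupling coefficient `α_{lj}`. The functions `φ_l`, `γ₀ φ_{jz}`, `γ₀ φ_{lz}` are continuous
at `z = h₀`; their values there are written with the piece `above`. -/
def α (k : ℕ → ℝ → ℝ) (φ : ℕ → Side → ℝ → ℝ → ℝ) (l j : ℕ) (X Y : ℝ) : ℂ :=
  W.depthIntegral (fun s z => (W.γ₀ s X z : ℂ) * W.ν s X Y z * (φ j s X z : ℂ) * (φ l s X z : ℂ)) X
    + W.depthIntegral (fun s z =>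
        (W.γ₁ s X Y z * ((W.n₀ s X z) ^ 2 - (k j X) ^ 2) * φ j s X z * φ l s X z : ℝ)) X
    - W.depthIntegral (fun s z =>
        (W.γ₁ s X Y z * deriv (φ j s X) z * deriv (φ l s X) z : ℝ)) X
    - Complex.I * (k j X : ℂ) * (W.C φ l j X - W.C φ j l X)
    + ((W.h₁ X Y : ℂ) * (φ l .above X (W.h₀ X) : ℂ)
          * W.jump (fun s z => (deriv (fun t => W.γ₀ s X t * deriv (φ j s X) t) z : ℝ)) X
        - (W.h₁ X Y : ℂ) * (W.γ₀ .above X (W.h₀ X) : ℂ) ^ 2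
          * ((deriv (φ j .above X) (W.h₀ X) : ℝ) : ℂ) * ((deriv (φ l .above X) (W.h₀ X) : ℝ) : ℂ)
          * W.jump (fun s z => (1 / W.γ₀ s X z : ℝ)) X)

/-- The left-hand side of the `l`-th mode parabolic equation,
`2 i k_l A_{l,X} + i k_{l,X} A_l + A_{l,YY} + α_{ll} A_l + ∑_{j ≠ l} α_{lj} A_j exp (θ_{lj})`,
`θ_{lj} = (i / ε) (θ_j - θ_l)`. -/
def mpe (J : Finset ℕ) (ε : ℝ) (θ k : ℕ → ℝ → ℝ) (φ : ℕ → Side → ℝ → ℝ → ℝ)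
    (A : ℕ → ℝ → ℝ → ℂ) (l : ℕ) (X Y : ℝ) : ℂ :=
  2 * Complex.I * (k l X : ℂ) * deriv (fun t => A l t Y) X
    + Complex.I * ((deriv (k l) X : ℝ) : ℂ) * A l X Y
    + iteratedDeriv 2 (A l X) Y
    + W.α k φ l l X Y * A l X Y
    + ∑ j ∈ J.erase l, W.α k φ l j X Y * A j X Y
        * Complex.exp (Complex.I / ε * (θ j X - θ l X))

end Waveguide

end

/-!
At order `ε` the Helmholtz equation reads `∑_j (L_j u₁⁽ʲ⁾ + F_j) exp (i θ_j / ε) = 0` with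
`L_j = (γ₀ ∂_z)_z + γ₀ (n₀² - k_j²)` and a source `F_j` built from `A_j φ_j`, while the interface
conditions prescribe the jumps of `u₁⁽ʲ⁾` and of its flux at `z = h₀`. Green's identity against
`φ_l` turns `∫ (L_j u₁⁽ʲ⁾) φ_l dz` into `(k_l² - k_j²) B_{jl}` and the jump data. Differentiating
`∫ γ₀ φ_j φ_l dz = δ_{jl}` in `X` eliminates the terms with `γ_{0,X}` and `h_{0,X}` and produces the
constants `C_{jl}`. The sum of these contributions `c_{lj}` of `A_j`, with their phases, is the
left-hand side of the `l`-th mode parabolic equation.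

Conversely, `L_j u₁⁽ʲ⁾ + F_j = ∑_l c_{lj} γ₀ φ_l` can be solved from the bottom upwards as an
initial value problem, and when the mode parabolic equations hold the right-hand sides cancel in the
sum over `j`. Green's identity against `φ_j` leaves only the term `γ₀ φ_{j,z} u₁⁽ʲ⁾` at `z = 0`, so
the surface condition is automatic because `φ_{j,z}(0) ≠ 0`. Against the other `φ_l` it then gives
`B_{jl} = 0`, so the solution has no resonant part.
-/

section Calculus

open Filter Topology

variable {E F : Type*} [NormedAddCommGroup E] [NormedSpace ℝ E] [NormedAddCommGroup F]
  [NormedSpace ℝ F]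

theorem contDiffAt_succ_of_eventually_hasDerivAt {n : ℕ} {f d : ℝ → F} {z : ℝ}
    (hf : ∀ᶠ t in 𝓝 z, HasDerivAt f (d t) t) (hd : ContDiffAt ℝ n d z) :
    ContDiffAt ℝ (n + 1) f z := by
  refine contDiffAt_succ_iff_hasFDerivAt.2
    ⟨fun t => ContinuousLinearMap.toSpanSingleton ℝ (d t), ⟨_, hf, fun t ht => ht.hasFDerivAt⟩, ?_⟩
  exact (ContinuousLinearMap.toSpanSingletonCLE (𝕜 := ℝ) (E := F)).contDiff.contDiffAt.comp z hd

theorem contDiffAt_ofReal_comp {n : WithTop ℕ∞} {f : E → ℝ} {x : E} (hf : ContDiffAt ℝ n f x) :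
    ContDiffAt ℝ n (fun t => (f t : ℂ)) x :=
  Complex.ofRealCLM.contDiff.contDiffAt.comp x hf

theorem deriv_ofReal_comp (f : ℝ → ℝ) (z : ℝ) :
    deriv (fun t => (f t : ℂ)) z = ((deriv f z : ℝ) : ℂ) := by
  by_cases hf : DifferentiableAt ℝ f z
  · exact hf.hasDerivAt.ofReal_comp.deriv
  · rw [deriv_zero_of_not_differentiableAt hf, deriv_zero_of_not_differentiableAt,
      Complex.ofReal_zero]
    exact fun h => hf (Complex.reCLM.differentiableAt.comp z h)

theorem continuousOn_deriv_of_contDiffAt {f : ℝ → F} {S : Set ℝ}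
    (hf : ∀ z ∈ S, ContDiffAt ℝ 1 f z) : ContinuousOn (deriv f) S := fun z hz =>
  ((hf z hz).derivWithin (m := 0) le_rfl).continuousAt.continuousWithinAt

theorem contDiffAt_of_uncurry_left {n : WithTop ℕ∞} {f : ℝ → ℝ → F} {x z : ℝ}
    (hf : ContDiffAt ℝ n (fun p : ℝ × ℝ => f p.1 p.2) (x, z)) :
    ContDiffAt ℝ n (fun t => f t z) x :=
  ContDiffAt.comp (f := fun t : ℝ => (t, z)) x hf (by fun_prop)

theorem contDiffAt_of_uncurry_right {n : WithTop ℕ∞} {f : ℝ → ℝ → F} {x z : ℝ}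
    (hf : ContDiffAt ℝ n (fun p : ℝ × ℝ => f p.1 p.2) (x, z)) : ContDiffAt ℝ n (f x) z :=
  ContDiffAt.comp (f := fun t : ℝ => (x, t)) z hf (by fun_prop)

theorem continuousAt_deriv_uncurry_left {f : ℝ → ℝ → F} {x z : ℝ}
    (hf : ContDiffAt ℝ 1 (fun p : ℝ × ℝ => f p.1 p.2) (x, z)) :
    ContinuousAt (fun p : ℝ × ℝ => deriv (fun t => f t p.2) p.1) (x, z) := by
  refine ((hf.continuousAt_fderiv one_ne_zero).clm_apply
    (continuousAt_const (y := ((1, 0) : ℝ × ℝ)))).congr ?_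
  filter_upwards [hf.eventually (by simp)] with p hp
  have hline : HasDerivAt (fun t : ℝ => (t, p.2)) ((1 : ℝ), (0 : ℝ)) p.1 :=
    (hasDerivAt_id _).prodMk (hasDerivAt_const _ _)
  exact (HasFDerivAt.comp_hasDerivAt p.1
    (hp.differentiableAt one_ne_zero).hasFDerivAt hline).deriv.symm

theorem continuousOn_of_uncurry_right {f : ℝ → ℝ → F} {x : ℝ} {S : Set ℝ}
    (hf : ∀ z ∈ S, ContDiffAt ℝ 1 (fun p : ℝ × ℝ => f p.1 p.2) (x, z)) :
    ContinuousOn (f x) S := fun z hz =>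
  (contDiffAt_of_uncurry_right (hf z hz)).continuousAt.continuousWithinAt

theorem continuousOn_deriv_uncurry_left {f : ℝ → ℝ → F} {x : ℝ} {S : Set ℝ}
    (hf : ∀ z ∈ S, ContDiffAt ℝ 1 (fun p : ℝ × ℝ => f p.1 p.2) (x, z)) :
    ContinuousOn (fun z => deriv (fun t => f t z) x) S := fun z hz =>
  (ContinuousAt.comp (f := fun t => (x, t)) (continuousAt_deriv_uncurry_left (hf z hz))
    (by fun_prop)).continuousWithinAt

end Calculus

section InitialValueProblem

open Set Filter Topology
open scoped NNReal

variable {E : Type*} [NormedAddCommGroup E] [NormedSpace ℝ E] {a b : ℝ}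

theorem exists_Icc_superset_of_eventually {p : ℝ → Prop} (hab : a ≤ b)
    (h : ∀ z ∈ Icc a b, ∀ᶠ t in 𝓝 z, p t) : ∃ c < a, ∃ d > b, ∀ t ∈ Icc c d, p t := by
  obtain ⟨l, hl, hla⟩ := exists_Ioc_subset_of_mem_nhds (h a (left_mem_Icc.2 hab)) ⟨a - 1, by simp⟩
  obtain ⟨r, hr, hbr⟩ := exists_Ico_subset_of_mem_nhds (h b (right_mem_Icc.2 hab)) ⟨b + 1, by simp⟩
  obtain ⟨c, hlc, hca⟩ := exists_between hl
  obtain ⟨d, hbd, hdr⟩ := exists_between hr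
  refine ⟨c, hca, d, hbd, fun t ht => ?_⟩
  rcases le_total t a with hta | hat
  · exact hla ⟨hlc.trans_le ht.1, hta⟩
  rcases le_total t b with htb | hbt
  · exact (h t ⟨hat, htb⟩).self_of_nhds
  · exact hbr ⟨hbt, ht.2.trans_lt hdr⟩

theorem hasDerivWithinAt_Icc_of_eqOn {m : ℝ} (ham : a ≤ m) (hmb : m ≤ b) {f : ℝ → E → E}
    {y y₁ y₂ : ℝ → E} (h₁ : EqOn y y₁ (Icc a m)) (h₂ : EqOn y y₂ (Icc m b))
    (hy₁ : ∀ t ∈ Icc a m, HasDerivWithinAt y₁ (f t (y₁ t)) (Icc a m) t)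
    (hy₂ : ∀ t ∈ Icc m b, HasDerivWithinAt y₂ (f t (y₂ t)) (Icc m b) t) :
    ∀ t ∈ Icc a b, HasDerivWithinAt y (f t (y t)) (Icc a b) t := by
  have hleft : ∀ t ∈ Icc a m, HasDerivWithinAt y (f t (y t)) (Icc a m) t := fun t ht =>
    h₁ ht ▸ (hy₁ t ht).congr h₁ (h₁ ht)
  have hright : ∀ t ∈ Icc m b, HasDerivWithinAt y (f t (y t)) (Icc m b) t := fun t ht =>
    h₂ ht ▸ (hy₂ t ht).congr h₂ (h₂ ht)
  intro t ht
  rcases lt_trichotomy t m with htm | rfl | hmt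
  · exact (hleft t ⟨ht.1, htm.le⟩).mono_of_mem_nhdsWithin
      (mem_of_superset (inter_mem_nhdsWithin _ (Iic_mem_nhds htm)) fun s hs => ⟨hs.1.1, hs.2⟩)
  · rw [← Icc_union_Icc_eq_Icc ham hmb]
    exact (hleft t ⟨ham, le_rfl⟩).union (hright t ⟨le_rfl, hmb⟩)
  · exact (hright t ⟨hmt.le, ht.2⟩).mono_of_mem_nhdsWithin
      (mem_of_superset (inter_mem_nhdsWithin _ (Ici_mem_nhds hmt)) fun s hs => ⟨hs.2, hs.1.2⟩)

theorem exists_hasDerivWithinAt_Icc_of_split {m : ℝ} (ham : a ≤ m) (hmb : m ≤ b) {f : ℝ → E → E}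
    (hleft : ∀ t₀ ∈ Icc a m, ∀ x₀, ∃ y : ℝ → E, y t₀ = x₀ ∧
      ∀ t ∈ Icc a m, HasDerivWithinAt y (f t (y t)) (Icc a m) t)
    (hright : ∀ t₀ ∈ Icc m b, ∀ x₀, ∃ y : ℝ → E, y t₀ = x₀ ∧
      ∀ t ∈ Icc m b, HasDerivWithinAt y (f t (y t)) (Icc m b) t)
    {t₀ : ℝ} (ht₀ : t₀ ∈ Icc a b) (x₀ : E) :
    ∃ y : ℝ → E, y t₀ = x₀ ∧ ∀ t ∈ Icc a b, HasDerivWithinAt y (f t (y t)) (Icc a b) t := by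
  rcases le_total t₀ m with htm | hmt
  · obtain ⟨y₁, hy₁t, hy₁⟩ := hleft t₀ ⟨ht₀.1, htm⟩ x₀
    obtain ⟨y₂, hy₂m, hy₂⟩ := hright m ⟨le_rfl, hmb⟩ (y₁ m)
    refine ⟨fun t => if t ≤ m then y₁ t else y₂ t, by simp only [htm, if_true, hy₁t],
      hasDerivWithinAt_Icc_of_eqOn ham hmb (fun t ht => if_pos ht.2) (fun t ht => ?_) hy₁ hy₂⟩
    rcases ht.1.eq_or_lt with rfl | hmt
    · exact (if_pos le_rfl).trans hy₂m.symm
    · exact if_neg hmt.not_ge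
  · obtain ⟨y₂, hy₂t, hy₂⟩ := hright t₀ ⟨hmt, ht₀.2⟩ x₀
    obtain ⟨y₁, hy₁m, hy₁⟩ := hleft m ⟨ham, le_rfl⟩ (y₂ m)
    refine ⟨fun t => if m ≤ t then y₂ t else y₁ t, by simp only [hmt, if_true, hy₂t],
      hasDerivWithinAt_Icc_of_eqOn ham hmb (fun t ht => ?_) (fun t ht => if_pos ht.1) hy₁ hy₂⟩
    rcases ht.2.eq_or_lt with rfl | htm
    · exact (if_pos le_rfl).trans hy₁m.symm
    · exact if_neg htm.not_ge

variable [CompleteSpace E] {f : ℝ → E → E} {K : ℝ≥0}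

/-- A ball of radius `2 C (b - a)` is invariant under the Picard iteration when the field is bounded
by `C` at its centre and `K (b - a) ≤ 1 / 2`. -/
theorem exists_hasDerivWithinAt_Icc_of_lipschitzWith_of_small
    (hK : ∀ t ∈ Icc a b, LipschitzWith K (f t)) (hf : ∀ x, ContinuousOn (f · x) (Icc a b))
    (hsmall : K * (b - a) ≤ 1 / 2) {t₀ : ℝ} (ht₀ : t₀ ∈ Icc a b) (x₀ : E) :
    ∃ y : ℝ → E, y t₀ = x₀ ∧ ∀ t ∈ Icc a b, HasDerivWithinAt y (f t (y t)) (Icc a b) t := by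
  obtain ⟨C, hC⟩ := isCompact_Icc.exists_bound_of_continuousOn (hf x₀)
  have hC₀ : 0 ≤ C := (norm_nonneg _).trans (hC t₀ ht₀)
  have hba : 0 ≤ b - a := sub_nonneg.2 (ht₀.1.trans ht₀.2)
  let R : ℝ≥0 := ⟨2 * C * (b - a), by positivity⟩
  have hPL : IsPicardLindelof f (⟨t₀, ht₀⟩ : Icc a b) x₀ R 0 (⟨C, hC₀⟩ + K * R) K := by
    refine ⟨fun t ht => (hK t ht).lipschitzOnWith, fun x _ => hf x, fun t ht x hx => ?_, ?_⟩
    · calc ‖f t x‖ ≤ ‖f t x₀‖ + ‖f t x - f t x₀‖ := norm_le_norm_add_norm_sub' _ _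
        _ ≤ C + K * R := by
          gcongr
          · exact hC t ht
          · exact ((hK t ht).norm_sub_le x x₀).trans (by gcongr; exact mem_closedBall_iff_norm.1 hx)
    · calc (C + K * (2 * C * (b - a))) * max (b - t₀) (t₀ - a)
          ≤ (C + K * (2 * C * (b - a))) * (b - a) := by
            gcongr
            exact max_le (by linarith [ht₀.1]) (by linarith [ht₀.2])
        _ = C * (b - a) + K * (b - a) * (2 * C * (b - a)) := by ring
        _ ≤ C * (b - a) + 1 / 2 * (2 * C * (b - a)) := by gcongr
        _ = 2 * C * (b - a) - 0 := by ring
  exact hPL.exists_eq_forall_mem_Icc_hasDerivWithinAt₀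

theorem exists_hasDerivWithinAt_Icc_of_lipschitzWith
    (hK : ∀ t ∈ Icc a b, LipschitzWith K (f t)) (hf : ∀ x, ContinuousOn (f · x) (Icc a b))
    {t₀ : ℝ} (ht₀ : t₀ ∈ Icc a b) (x₀ : E) :
    ∃ y : ℝ → E, y t₀ = x₀ ∧ ∀ t ∈ Icc a b, HasDerivWithinAt y (f t (y t)) (Icc a b) t := by
  obtain ⟨n, hn⟩ : ∃ n : ℕ, K * (b - a) ≤ 2 ^ n / 2 := by
    obtain ⟨n, hn⟩ := pow_unbounded_of_one_lt (K * (b - a) * 2) one_lt_two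
    exact ⟨n, by linarith⟩
  induction n generalizing a b t₀ x₀ with
  | zero =>
    exact exists_hasDerivWithinAt_Icc_of_lipschitzWith_of_small hK hf (by simpa using hn) ht₀ x₀
  | succ n ih =>
    have hab : a ≤ b := ht₀.1.trans ht₀.2
    have ham : a ≤ midpoint ℝ a b := left_le_midpoint.2 hab
    have hmb : midpoint ℝ a b ≤ b := midpoint_le_right.2 hab
    have hhalf : K * ((b - a) / 2) ≤ 2 ^ n / 2 := by rw [pow_succ] at hn; linarith
    refine exists_hasDerivWithinAt_Icc_of_split ham hmb (fun t₀ ht₀ x₀ => ?_)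
      (fun t₀ ht₀ x₀ => ?_) ht₀ x₀
    · exact ih (fun t ht => hK t ⟨ht.1, ht.2.trans hmb⟩)
        (fun x => (hf x).mono (Icc_subset_Icc_right hmb)) ht₀ x₀ (by
          simpa [midpoint_sub_left, div_eq_inv_mul] using hhalf)
    · exact ih (fun t ht => hK t ⟨ham.trans ht.1, ht.2⟩)
        (fun x => (hf x).mono (Icc_subset_Icc_left ham)) ht₀ x₀ (by
          simpa [right_sub_midpoint, div_eq_inv_mul] using hhalf)

end InitialValueProblem

section SturmLiouville

open Set Filter Topology

variable {E : Type*} [NormedAddCommGroup E] [NormedSpace ℝ E] {a b : ℝ} {γ q : ℝ → ℝ}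

/-- The first-order system satisfied by `(u, γ u')` when `(γ u')' + q u = g`. -/
noncomputable def sturmLiouvilleField (γ q : ℝ → ℝ) (g : ℝ → E) (t : ℝ) (y : E × E) : E × E :=
  ((γ t)⁻¹ • y.2, g t - q t • y.1)

theorem exists_lipschitzWith_sturmLiouvilleField (hγ : ContinuousOn γ (Icc a b))
    (hγ₀ : ∀ z ∈ Icc a b, γ z ≠ 0) (hq : ContinuousOn q (Icc a b)) (g : ℝ → E) :
    ∃ K, ∀ t ∈ Icc a b, LipschitzWith K (sturmLiouvilleField γ q g t) := by
  obtain ⟨C, hC⟩ := isCompact_Icc.exists_bound_of_continuousOn (hγ.inv₀ hγ₀)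
  obtain ⟨D, hD⟩ := isCompact_Icc.exists_bound_of_continuousOn hq
  refine ⟨max C.toNNReal D.toNNReal, fun t ht => ?_⟩
  have hC' : ‖(γ t)⁻¹‖₊ ≤ C.toNNReal := NNReal.le_toNNReal_of_coe_le (hC t ht)
  have hD' : ‖q t‖₊ ≤ D.toNNReal := NNReal.le_toNNReal_of_coe_le (hD t ht)
  refine LipschitzWith.prodMk ?_ ?_
  · exact ((lipschitzWith_smul (γ t)⁻¹).comp LipschitzWith.prod_snd).weaken (by simpa using hC')
  · have h := (LipschitzWith.const (g t)).sub ((lipschitzWith_smul (q t)).comp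
      (LipschitzWith.prod_fst (α := E) (β := E)))
    exact h.weaken (by simpa using hD')

theorem hasDerivAt_sturmLiouvilleField {u g : ℝ → E} {z : ℝ} (hγ : ContDiffAt ℝ 1 γ z)
    (hγ₀ : γ z ≠ 0) (hu : ContDiffAt ℝ 2 u z)
    (h : deriv (fun t => γ t • deriv u t) z + q z • u z = g z) :
    HasDerivAt (fun t => (u t, γ t • deriv u t))
      (sturmLiouvilleField γ q g z (u z, γ z • deriv u z)) z := by
  have hu' := (hu.differentiableAt two_ne_zero).hasDerivAt
  have hflux : HasDerivAt (fun t => γ t • deriv u t) (g z - q z • u z) z :=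
    eq_sub_of_add_eq h ▸ ((hγ.smul (hu.derivWithin (m := 1) le_rfl)).differentiableAt
      one_ne_zero).hasDerivAt
  simpa only [sturmLiouvilleField, inv_smul_smul₀ hγ₀] using hu'.prodMk hflux

theorem eqOn_zero_of_sturmLiouville {u : ℝ → E} (hγ : ∀ z ∈ Icc a b, ContDiffAt ℝ 1 γ z)
    (hγ₀ : ∀ z ∈ Icc a b, γ z ≠ 0) (hq : ContinuousOn q (Icc a b))
    (hu : ∀ z ∈ Icc a b, ContDiffAt ℝ 2 u z)
    (heq : ∀ z ∈ Icc a b, deriv (fun t => γ t • deriv u t) z + q z • u z = 0)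
    {c : ℝ} (hc : c = a ∨ c = b) (huc : u c = 0) (huc' : deriv u c = 0) :
    EqOn u 0 (Icc a b) := by
  obtain ⟨K, hK⟩ := exists_lipschitzWith_sturmLiouvilleField
    (fun z hz => (hγ z hz).continuousAt.continuousWithinAt) hγ₀ hq (0 : ℝ → E)
  have hy : ∀ z ∈ Icc a b, HasDerivAt (fun t => (u t, γ t • deriv u t))
      (sturmLiouvilleField γ q 0 z (u z, γ z • deriv u z)) z := fun z hz =>
    hasDerivAt_sturmLiouvilleField (hγ z hz) (hγ₀ z hz) (hu z hz) (heq z hz)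
  have hyc := HasDerivAt.continuousOn hy
  have h0 : ∀ z, HasDerivAt (fun _ : ℝ => (0 : E × E)) (sturmLiouvilleField γ q 0 z 0) z := by
    have hzero : ∀ z, sturmLiouvilleField γ q 0 z (0 : E × E) = 0 := by simp [sturmLiouvilleField]
    exact fun z => (hasDerivAt_const z _).congr_deriv (hzero z).symm
  have hinit : (u c, γ c • deriv u c) = (0 : E × E) := by simp [huc, huc']
  suffices EqOn (fun t => (u t, γ t • deriv u t)) (fun _ => 0) (Icc a b) from
    fun z hz => congrArg Prod.fst (this hz)
  rcases hc with rfl | rfl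
  · exact ODE_solution_unique_of_mem_Icc_right (s := fun _ => univ)
      (fun t ht => (hK t (Ico_subset_Icc_self ht)).lipschitzOnWith) hyc
      (fun t ht => (hy t (Ico_subset_Icc_self ht)).hasDerivWithinAt) (fun _ _ => mem_univ _)
      continuousOn_const (fun t _ => (h0 t).hasDerivWithinAt) (fun _ _ => mem_univ _) hinit
  · exact ODE_solution_unique_of_mem_Icc_left (s := fun _ => univ)
      (fun t ht => (hK t (Ioc_subset_Icc_self ht)).lipschitzOnWith) hyc
      (fun t ht => (hy t (Ioc_subset_Icc_self ht)).hasDerivWithinAt) (fun _ _ => mem_univ _)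
      continuousOn_const (fun t _ => (h0 t).hasDerivWithinAt) (fun _ _ => mem_univ _) hinit

theorem contDiffAt_two_of_sturmLiouvilleField {g : ℝ → E} {y : ℝ → E × E} {z : ℝ}
    (hγ : ContDiffAt ℝ 1 γ z) (hγ₀ : γ z ≠ 0) (hq : Continuous q) (hg : Continuous g)
    (hy : ∀ᶠ t in 𝓝 z, HasDerivAt y (sturmLiouvilleField γ q g t (y t)) t) :
    ContDiffAt ℝ 2 (fun t => (y t).1) z ∧
      ∀ᶠ t in 𝓝 z, γ t • deriv (fun t => (y t).1) t = (y t).2 := by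
  have hfst : ∀ᶠ t in 𝓝 z, HasDerivAt (fun t => (y t).1) ((γ t)⁻¹ • (y t).2) t :=
    hy.mono fun t ht => (hasFDerivAt_fst (𝕜 := ℝ) (p := y t)).comp_hasDerivAt t ht
  have hsnd : ∀ᶠ t in 𝓝 z, HasDerivAt (fun t => (y t).2) (g t - q t • (y t).1) t :=
    hy.mono fun t ht => (hasFDerivAt_snd (𝕜 := ℝ) (p := y t)).comp_hasDerivAt t ht
  have hcont : ContDiffAt ℝ (0 : ℕ) (fun t => g t - q t • (y t).1) z :=
    contDiffAt_zero.2 ⟨_, hy, hg.continuousOn.sub (hq.continuousOn.smul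
      (continuous_fst.comp_continuousOn (HasDerivAt.continuousOn fun t ht => ht)))⟩
  have hflux : ContDiffAt ℝ 1 (fun t => (y t).2) z :=
    contDiffAt_succ_of_eventually_hasDerivAt hsnd hcont
  refine ⟨contDiffAt_succ_of_eventually_hasDerivAt (n := 1) hfst ((hγ.inv hγ₀).smul hflux), ?_⟩
  filter_upwards [hfst, hγ.continuousAt.eventually_ne hγ₀] with t ht hγt
  rw [ht.deriv, smul_inv_smul₀ hγt]

theorem exists_sturmLiouville_initialValue [CompleteSpace E] {g : ℝ → E} (hab : a ≤ b)
    (hγ : ∀ z ∈ Icc a b, ContDiffAt ℝ 1 γ z) (hγ₀ : ∀ z ∈ Icc a b, γ z ≠ 0)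
    (hq : ContinuousOn q (Icc a b)) (hg : ContinuousOn g (Icc a b)) (u₀ p₀ : E) :
    ∃ u : ℝ → E, (∀ z ∈ Icc a b, ContDiffAt ℝ 2 u z) ∧ u a = u₀ ∧ γ a • deriv u a = p₀ ∧
      ∀ z ∈ Icc a b, deriv (fun t => γ t • deriv u t) z + q z • u z = g z := by
  obtain ⟨c, hca, d, hbd, hcd⟩ := exists_Icc_superset_of_eventually hab fun z hz =>
    ((hγ z hz).eventually (by simp)).and ((hγ z hz).continuousAt.eventually_ne (hγ₀ z hz))
  let Q : ℝ → ℝ := IccExtend hab fun t : Icc a b => q t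
  let G : ℝ → E := IccExtend hab fun t : Icc a b => g t
  have hQ : Continuous Q := hq.domRestrict.Icc_extend'
  have hG : Continuous G := hg.domRestrict.Icc_extend'
  have hγc : ContinuousOn γ (Icc c d) := fun z hz => (hcd z hz).1.continuousAt.continuousWithinAt
  have hγc₀ : ∀ z ∈ Icc c d, γ z ≠ 0 := fun z hz => (hcd z hz).2
  obtain ⟨K, hK⟩ := exists_lipschitzWith_sturmLiouvilleField hγc hγc₀ hQ.continuousOn G
  obtain ⟨y, hya, hy⟩ := exists_hasDerivWithinAt_Icc_of_lipschitzWith hK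
    (fun x => ((hγc.inv₀ hγc₀).smul continuousOn_const).prodMk
      (hG.continuousOn.sub (hQ.continuousOn.smul continuousOn_const)))
    (t₀ := a) ⟨hca.le, hab.trans hbd.le⟩ (u₀, p₀)
  have hy' : ∀ z ∈ Icc a b, ∀ᶠ t in 𝓝 z, HasDerivAt y (sturmLiouvilleField γ Q G t (y t)) t := by
    intro z hz
    filter_upwards [Ioo_mem_nhds (hca.trans_le hz.1) (hz.2.trans_lt hbd)] with t ht
    exact (hy t (Ioo_subset_Icc_self ht)).hasDerivAt (Icc_mem_nhds ht.1 ht.2)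
  have hu := fun z hz =>
    contDiffAt_two_of_sturmLiouvilleField (hγ z hz) (hγ₀ z hz) hQ hG (hy' z hz)
  refine ⟨fun t => (y t).1, fun z hz => (hu z hz).1, congrArg Prod.fst hya, ?_, fun z hz => ?_⟩
  · rw [(hu a (left_mem_Icc.2 hab)).2.self_of_nhds, hya]
  · have hflux : HasDerivAt (fun t => (y t).2) (G z - Q z • (y z).1) z :=
      (hasFDerivAt_snd (𝕜 := ℝ) (p := y z)).comp_hasDerivAt z (hy' z hz).self_of_nhds
    have hQz : Q z = q z := IccExtend_of_mem _ _ hz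
    have hGz : G z = g z := IccExtend_of_mem _ _ hz
    rw [EventuallyEq.deriv_eq (hu z hz).2, hflux.deriv, hQz, hGz, sub_add_cancel]

end SturmLiouville

section MovingBoundary

open Set Filter Topology intervalIntegral

variable {F : Type*} [NormedAddCommGroup F] [NormedSpace ℝ F] {f : ℝ → ℝ → F} {a x₀ : ℝ}

theorem hasDerivAt_integral_of_contDiffAt {c : ℝ}
    (hf : ∀ z ∈ uIcc a c, ContDiffAt ℝ 1 (fun p : ℝ × ℝ => f p.1 p.2) (x₀, z)) :
    HasDerivAt (fun x => ∫ z in a..c, f x z) (∫ z in a..c, deriv (fun t => f t z) x₀) x₀ := by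
  have hcont : ContinuousOn (fun z => deriv (fun t => f t z) x₀) (uIcc a c) :=
    continuousOn_deriv_uncurry_left hf
  obtain ⟨C, hC⟩ := isCompact_uIcc.exists_bound_of_continuousOn hcont
  have hev : ∀ᶠ x in 𝓝 x₀, ∀ z ∈ uIcc a c,
      ContDiffAt ℝ 1 (fun p : ℝ × ℝ => f p.1 p.2) (x, z) ∧ ‖deriv (fun t => f t z) x‖ ≤ C + 1 := by
    refine isCompact_uIcc.eventually_forall_of_forall_eventually fun z hz => ?_
    refine ((hf z hz).eventually (by simp)).and ?_
    exact ((continuousAt_deriv_uncurry_left (hf z hz)).norm.eventually_le_const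
      ((hC z hz).trans_lt (lt_add_one C)))
  have hslice : ∀ᶠ x in 𝓝 x₀, IntervalIntegrable (f x) MeasureTheory.volume a c :=
    hev.mono fun x hx =>
      (continuousOn_of_uncurry_right fun z hz => (hx z hz).1).intervalIntegrable
  refine (hasDerivAt_integral_of_dominated_loc_of_deriv_le
    (F' := fun x z => deriv (fun t => f t z) x) (bound := fun _ => C + 1) hev
    (hslice.mono fun x hx => (intervalIntegrable_iff.1 hx).aestronglyMeasurable)
    hslice.self_of_nhds (intervalIntegrable_iff.1 hcont.intervalIntegrable).aestronglyMeasurable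
    ?_ intervalIntegrable_const ?_).2
  · exact Eventually.of_forall fun z hz x hx => (hx z (uIoc_subset_uIcc hz)).2
  · exact Eventually.of_forall fun z hz x hx => ((contDiffAt_of_uncurry_left
      (hx z (uIoc_subset_uIcc hz)).1).differentiableAt one_ne_zero).hasDerivAt

theorem eventually_forall_uIcc_of_continuousAt {b : ℝ → ℝ} {p : ℝ × ℝ → Prop}
    (hb : ContinuousAt b x₀) (hp : ∀ᶠ y in 𝓝 (x₀, b x₀), p y) :
    ∀ᶠ x in 𝓝 x₀, ∀ z ∈ uIcc (b x₀) (b x), p (x, z) := by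
  obtain ⟨r, hr, h⟩ := Metric.eventually_nhds_iff_ball.1 hp
  filter_upwards [Metric.ball_mem_nhds x₀ hr, hb (Metric.ball_mem_nhds (b x₀) hr)]
    with x hx hbx z hz
  refine h _ (ball_prod_same x₀ (b x₀) r ▸ ⟨hx, ?_⟩)
  exact (convex_ball (b x₀) r).ordConnected.uIcc_subset (Metric.mem_ball_self hr) hbx hz

theorem hasDerivAt_integral_moving_end [CompleteSpace F] {b : ℝ → ℝ} {b' : ℝ}
    (hb : HasDerivAt b b' x₀) (hf : ContinuousAt (fun p : ℝ × ℝ => f p.1 p.2) (x₀, b x₀))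
    (hint : ∀ᶠ x in 𝓝 x₀, IntervalIntegrable (f x) MeasureTheory.volume (b x₀) (b x)) :
    HasDerivAt (fun x => ∫ z in b x₀..b x, f x z) (b' • f x₀ (b x₀)) x₀ := by
  have hmain : HasDerivAt (fun x => (b x - b x₀) • f x₀ (b x₀)) (b' • f x₀ (b x₀)) x₀ :=
    (hb.sub_const _).smul_const _
  have hrem : HasDerivAt (fun x => ∫ z in b x₀..b x, (f x z - f x₀ (b x₀))) 0 x₀ := by
    rw [hasDerivAt_iff_isLittleO]
    simp only [integral_same, sub_zero, smul_zero]
    refine Asymptotics.IsLittleO.trans_isBigO (Asymptotics.isLittleO_iff.2 fun c hc => ?_)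
      hb.isBigO_sub
    have hclose : ∀ᶠ p in 𝓝 (x₀, b x₀), ‖f p.1 p.2 - f x₀ (b x₀)‖ ≤ c :=
      (hf.sub continuousAt_const).norm.eventually_le_const (by simpa using hc)
    filter_upwards [eventually_forall_uIcc_of_continuousAt hb.continuousAt hclose] with x hx
    exact norm_integral_le_of_norm_le_const fun z hz => hx z (uIoc_subset_uIcc hz)
  refine (add_zero (b' • f x₀ (b x₀)) ▸ hmain.add hrem).congr_of_eventuallyEq ?_
  filter_upwards [hint] with x hx
  simp [integral_sub hx intervalIntegrable_const]

theorem hasDerivAt_integral_moving_right [CompleteSpace F] {b : ℝ → ℝ} {b' : ℝ}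
    (hf : ∀ z ∈ uIcc a (b x₀), ContDiffAt ℝ 1 (fun p : ℝ × ℝ => f p.1 p.2) (x₀, z))
    (hb : HasDerivAt b b' x₀) :
    HasDerivAt (fun x => ∫ z in a..b x, f x z)
      ((∫ z in a..b x₀, deriv (fun t => f t z) x₀) + b' • f x₀ (b x₀)) x₀ := by
  have hend := hf _ right_mem_uIcc
  have hint : ∀ᶠ x in 𝓝 x₀, IntervalIntegrable (f x) MeasureTheory.volume (b x₀) (b x) :=
    (eventually_forall_uIcc_of_continuousAt hb.continuousAt (hend.eventually (by simp))).mono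
      fun x hx => ContinuousOn.intervalIntegrable fun z hz =>
        (contDiffAt_of_uncurry_right (hx z hz)).continuousAt.continuousWithinAt
  have hfix : ∀ᶠ x in 𝓝 x₀, IntervalIntegrable (f x) MeasureTheory.volume a (b x₀) :=
    (isCompact_uIcc.eventually_forall_of_forall_eventually fun z hz =>
      (hf z hz).eventually (by simp)).mono fun x hx => ContinuousOn.intervalIntegrable fun z hz =>
        (contDiffAt_of_uncurry_right (f := f) (hx z hz)).continuousAt.continuousWithinAt
  refine ((hasDerivAt_integral_of_contDiffAt hf).add
    (hasDerivAt_integral_moving_end hb hend.continuousAt hint)).congr_of_eventuallyEq ?_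
  filter_upwards [hint, hfix] with x hx hx'
  exact (integral_add_adjacent_intervals hx' hx).symm

end MovingBoundary

noncomputable section

namespace Waveguide

section FormalCalculus

theorem coeff_termwise (D : Fld → Fld) (f : Expansion) (n : ℕ) :
    PowerSeries.coeff n (termwise D f) = D (PowerSeries.coeff n f) :=
  PowerSeries.coeff_mk _ _

theorem coeff_zero_mul (f g : Expansion) :
    PowerSeries.coeff 0 (f * g) = PowerSeries.coeff 0 f * PowerSeries.coeff 0 g := by
  simp only [PowerSeries.coeff_zero_eq_constantCoeff, map_mul]

theorem coeff_one_mul (f g : Expansion) :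
    PowerSeries.coeff 1 (f * g) = PowerSeries.coeff 0 f * PowerSeries.coeff 1 g
      + PowerSeries.coeff 1 f * PowerSeries.coeff 0 g := by
  rw [PowerSeries.coeff_one_mul, ← PowerSeries.coeff_zero_eq_constantCoeff]
  ring

theorem coeff_one_X_mul (f : Expansion) :
    PowerSeries.coeff 1 (PowerSeries.X * f) = PowerSeries.coeff 0 f :=
  PowerSeries.coeff_succ_X_mul 0 f

theorem coeff_zero_phaseDx (θ : ℝ → ℝ) (u : Expansion) :
    PowerSeries.coeff 0 (phaseDx θ u)
      = (fun X _ _ => Complex.I * ((deriv θ X : ℝ) : ℂ) : Fld) * PowerSeries.coeff 0 u := by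
  simp [phaseDx]

theorem coeff_one_phaseDx (θ : ℝ → ℝ) (u : Expansion) :
    PowerSeries.coeff 1 (phaseDx θ u)
      = (fun X _ _ => Complex.I * ((deriv θ X : ℝ) : ℂ) : Fld) * PowerSeries.coeff 1 u
        + dX (PowerSeries.coeff 0 u) := by
  rw [phaseDx, map_add, PowerSeries.coeff_C_mul, coeff_one_X_mul, coeff_termwise]

variable (W : Waveguide)

theorem coeff_zero_γ (s : Side) :
    PowerSeries.coeff 0 (W.γ s) = (fun X _ z => (W.γ₀ s X z : ℂ) : Fld) := by
  simp [γ]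

theorem coeff_one_γ (s : Side) :
    PowerSeries.coeff 1 (W.γ s) = (fun X Y z => (W.γ₁ s X Y z : ℂ) : Fld) := by
  simp [γ]

theorem coeff_zero_κsq (s : Side) :
    PowerSeries.coeff 0 (W.κsq s) = (fun X _ z => ((W.n₀ s X z) ^ 2 : ℂ) : Fld) := by
  simp [κsq]

theorem coeff_one_κsq (s : Side) : PowerSeries.coeff 1 (W.κsq s) = (W.ν s : Fld) := by
  simp [κsq]

theorem coeff_zero_h : PowerSeries.coeff 0 W.h = (fun X _ _ => (W.h₀ X : ℂ) : Fld) := by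
  simp [h]

theorem coeff_one_trace (f : Expansion) (X Y : ℝ) :
    PowerSeries.coeff 1 (W.trace f) X Y = PowerSeries.coeff 1 f X Y (W.h₀ X)
      + W.h₁ X Y * deriv (PowerSeries.coeff 0 f X Y) (W.h₀ X) := by
  simp [trace, Finset.sum_range_succ, iteratedDeriv_one]

theorem coeff_zero_flux (s : Side) (θ : ℝ → ℝ) (u : Expansion) :
    PowerSeries.coeff 0 (W.flux s θ u)
      = (fun X _ z => (W.γ₀ s X z : ℂ) : Fld) * dZ (PowerSeries.coeff 0 u) := by
  simp only [flux, coeff_zero_mul, coeff_zero_γ, mul_assoc, map_sub,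
    PowerSeries.coeff_zero_X_mul, coeff_termwise, sub_zero]

theorem coeff_one_flux (s : Side) (θ : ℝ → ℝ) (u : Expansion) {X : ℝ}
    (hX : DifferentiableAt ℝ W.h₀ X) (Y z : ℝ) :
    PowerSeries.coeff 1 (W.flux s θ u) X Y z
      = W.γ₀ s X z * (deriv (PowerSeries.coeff 1 u X Y) z
          - ((deriv W.h₀ X : ℝ) : ℂ)
            * (Complex.I * ((deriv θ X : ℝ) : ℂ) * PowerSeries.coeff 0 u X Y z))
        + W.γ₁ s X Y z * deriv (PowerSeries.coeff 0 u X Y) z := by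
  have hhX : dX (PowerSeries.coeff 0 W.h) X Y z = ((deriv W.h₀ X : ℝ) : ℂ) := by
    rw [coeff_zero_h]
    exact hX.hasDerivAt.ofReal_comp.deriv
  have hhY : dY (PowerSeries.coeff 0 W.h) = 0 := by
    rw [coeff_zero_h]
    funext X Y z
    simp only [dY, deriv_const, Pi.zero_apply]
  rw [flux, coeff_one_mul, coeff_zero_γ, coeff_one_γ]
  simp only [mul_assoc (PowerSeries.X : Expansion), map_sub, PowerSeries.coeff_zero_X_mul,
    coeff_termwise, sub_zero, coeff_one_X_mul, coeff_zero_mul, hhY, coeff_zero_phaseDx, zero_mul]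
  simp only [Pi.add_apply, Pi.mul_apply, Pi.sub_apply, hhX, dZ]

theorem coeff_one_helmholtz (s : Side) (θ : ℝ → ℝ) (u : Expansion) (X Y z : ℝ) :
    PowerSeries.coeff 1 (helmholtz (W.γ s) (W.κsq s) θ u) X Y z
      = deriv (fun t => (W.γ₀ s X t : ℂ) * deriv (PowerSeries.coeff 1 u X Y) t
            + W.γ₁ s X Y t * deriv (PowerSeries.coeff 0 u X Y) t) z
        + W.γ₀ s X z * ((W.n₀ s X z : ℂ) ^ 2 - ((deriv θ X : ℝ) : ℂ) ^ 2)
            * PowerSeries.coeff 1 u X Y z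
        + (W.γ₀ s X z * W.ν s X Y z
            + W.γ₁ s X Y z * ((W.n₀ s X z : ℂ) ^ 2 - ((deriv θ X : ℝ) : ℂ) ^ 2))
            * PowerSeries.coeff 0 u X Y z
        + deriv (fun t => (W.γ₀ s X z : ℂ) * deriv (fun t => PowerSeries.coeff 0 u X t z) t) Y
        + Complex.I * ((deriv θ X : ℝ) : ℂ) * W.γ₀ s X z
            * deriv (fun t => PowerSeries.coeff 0 u t Y z) X
        + deriv (fun t => (W.γ₀ s t z : ℂ) * (Complex.I * ((deriv θ t : ℝ) : ℂ)
            * PowerSeries.coeff 0 u t Y z)) X := by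
  simp only [helmholtz, map_add, coeff_one_phaseDx, coeff_one_X_mul]
  simp only [coeff_one_phaseDx, coeff_one_mul, coeff_termwise, coeff_zero_γ, coeff_one_γ,
    coeff_zero_κsq, coeff_one_κsq, coeff_zero_phaseDx, coeff_zero_mul]
  simp only [Pi.add_apply, Pi.mul_apply, dX, dY, dZ]
  linear_combination ((deriv θ X : ℝ) : ℂ) ^ 2 * (W.γ₀ s X z * PowerSeries.coeff 1 u X Y z
    + W.γ₁ s X Y z * PowerSeries.coeff 0 u X Y z) * Complex.I_sq

end FormalCalculus

section LeadingTerm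

variable {W : Waveguide} {I : Set ℝ} {X Y z : ℝ} {s : Side} {k : ℝ → ℝ}
  {φ : Side → ℝ → ℝ → ℝ}

theorem Regular.contDiffAt_γ₀ (hW : W.Regular I) (hX : X ∈ I) (hz : z ∈ W.layer s X) :
    ContDiffAt ℝ 1 (W.γ₀ s X) z :=
  contDiffAt_of_uncurry_right (hW.smooth_γ₀ s X hX z hz)

theorem IsMode.contDiffAt (hφ : W.IsMode I k φ) (hX : X ∈ I) (hz : z ∈ W.layer s X) :
    ContDiffAt ℝ 2 (φ s X) z :=
  contDiffAt_of_uncurry_right (hφ.smooth s X hX z hz)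

/-- The operator `(γ₀ ∂_z)_z + γ₀ n₀² - γ₀ κ²` of the modal problem, acting in each layer. -/
def modeOperator (W : Waveguide) (κ X : ℝ) (u : Side → ℝ → ℂ) (s : Side) (z : ℝ) : ℂ :=
  deriv (fun t => (W.γ₀ s X t : ℂ) * deriv (u s) t) z
    + ((W.γ₀ s X z * (W.n₀ s X z ^ 2 - κ ^ 2) : ℝ) : ℂ) * u s z

/-- The part of the Helmholtz equation at order `ε` contributed by the leading term `A φ`; the rest
is `modeOperator` acting on the first correction. -/
def source (W : Waveguide) (k : ℝ → ℝ) (φ : Side → ℝ → ℝ → ℝ) (A : ℝ → ℝ → ℂ) (X Y : ℝ)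
    (s : Side) (z : ℝ) : ℂ :=
  A X Y * ((deriv (fun t => W.γ₁ s X Y t * deriv (φ s X) t) z : ℝ) : ℂ)
    + A X Y * ((W.γ₁ s X Y z * (W.n₀ s X z ^ 2 - k X ^ 2) * φ s X z : ℝ) : ℂ)
    + A X Y * (W.γ₀ s X z * W.ν s X Y z * φ s X z)
    + (2 * Complex.I * k X * deriv (fun t => A t Y) X + Complex.I * ((deriv k X : ℝ) : ℂ) * A X Y
        + iteratedDeriv 2 (A X) Y) * ((W.γ₀ s X z * φ s X z : ℝ) : ℂ)
    + Complex.I * k X * A X Y * ((deriv (fun t => W.γ₀ s t z) X * φ s X z : ℝ) : ℂ)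
    + 2 * (Complex.I * k X * A X Y) * ((W.γ₀ s X z * deriv (fun t => φ s t z) X : ℝ) : ℂ)

theorem deriv_mul_deriv_add_mul_deriv_const_mul {g₀ g₁ v : ℝ → ℝ} {w : ℝ → ℂ}
    (hg₀ : ContDiffAt ℝ 1 g₀ z) (hw : ContDiffAt ℝ 2 w z) (hg₁ : ContDiffAt ℝ 1 g₁ z)
    (hv : ContDiffAt ℝ 2 v z) (a : ℂ) :
    deriv (fun t => (g₀ t : ℂ) * deriv w t + g₁ t * deriv (fun r => a * (v r : ℂ)) t) z
      = deriv (fun t => (g₀ t : ℂ) * deriv w t) z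
        + a * ((deriv (fun t => g₁ t * deriv v t) z : ℝ) : ℂ) := by
  have hflux : ∀ t, (g₁ t : ℂ) * deriv (fun r => a * (v r : ℂ)) t
      = a * ((g₁ t * deriv v t : ℝ) : ℂ) := fun t => by
    rw [deriv_const_mul_field, deriv_ofReal_comp]
    push_cast
    ring
  simp only [hflux]
  rw [deriv_fun_add, deriv_const_mul_field, deriv_ofReal_comp]
  · exact ((contDiffAt_ofReal_comp hg₀).mul (hw.derivWithin (m := 1) le_rfl)).differentiableAt
      one_ne_zero
  · exact ((contDiffAt_ofReal_comp (hg₁.mul (hv.derivWithin (m := 1) le_rfl))).differentiableAt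
      one_ne_zero).const_mul a

theorem coeff_one_helmholtz_of_leadingTerm (hI : IsOpen I) (hW : W.Regular I)
    (hφ : W.IsMode I k φ) {θ : ℝ → ℝ} (hθ : ∀ X ∈ I, HasDerivAt θ (k X) X) {A : ℝ → ℝ → ℂ}
    (hX : X ∈ I) (hA : DifferentiableAt ℝ (fun t => A t Y) X) {u : Side → Expansion}
    (hu₀ : PowerSeries.coeff 0 (u s) = fun X Y z => A X Y * (φ s X z : ℂ))
    (hz : z ∈ W.layer s X) (hu₁ : ContDiffAt ℝ 2 (PowerSeries.coeff 1 (u s) X Y) z) :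
    PowerSeries.coeff 1 (helmholtz (W.γ s) (W.κsq s) θ (u s)) X Y z
      = W.modeOperator (k X) X (fun s => PowerSeries.coeff 1 (u s) X Y) s z
        + W.source k φ A X Y s z := by
  have hγX := ((contDiffAt_of_uncurry_left (hW.smooth_γ₀ s X hX z hz)).differentiableAt
    one_ne_zero).hasDerivAt.ofReal_comp
  have hφX := ((contDiffAt_of_uncurry_left (hφ.smooth s X hX z hz)).differentiableAt
    two_ne_zero).hasDerivAt.ofReal_comp
  have hθk : deriv θ =ᶠ[nhds X] k := (hI.eventually_mem hX).mono fun t ht => (hθ t ht).deriv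
  have hphase : deriv (fun t => (W.γ₀ s t z : ℂ) * (Complex.I * ((deriv θ t : ℝ) : ℂ)
      * (A t Y * (φ s t z : ℂ)))) X
      = ((deriv (fun t => W.γ₀ s t z) X : ℝ) : ℂ) * (Complex.I * k X * (A X Y * φ s X z))
        + W.γ₀ s X z * (Complex.I * ((deriv k X : ℝ) : ℂ) * (A X Y * φ s X z)
          + Complex.I * k X * (deriv (fun t => A t Y) X * φ s X z
            + A X Y * ((deriv (fun t => φ s t z) X : ℝ) : ℂ))) := by
    rw [Filter.EventuallyEq.deriv_eq (f := fun t => (W.γ₀ s t z : ℂ) * (Complex.I * (k t : ℂ)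
      * (A t Y * (φ s t z : ℂ)))) (hθk.mono fun t ht => by rw [ht])]
    exact (hγX.mul (((hφ.differentiable_k X hX).hasDerivAt.ofReal_comp.const_mul Complex.I).mul
      (hA.hasDerivAt.mul hφX))).deriv
  have hAφ : deriv (fun t => A t Y * (φ s t z : ℂ)) X
      = deriv (fun t => A t Y) X * φ s X z + A X Y * ((deriv (fun t => φ s t z) X : ℝ) : ℂ) :=
    (hA.hasDerivAt.mul hφX).deriv
  rw [coeff_one_helmholtz, hu₀, deriv_mul_deriv_add_mul_deriv_const_mul (hW.contDiffAt_γ₀ hX hz)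
    hu₁ (hW.smooth_γ₁ s X hX Y z hz) (hφ.contDiffAt hX hz), hphase, hAφ, hθk.self_of_nhds,
    modeOperator, source, iteratedDeriv_succ, iteratedDeriv_one]
  simp only [deriv_mul_const_field', deriv_const_mul_field]
  push_cast
  ring

end LeadingTerm

section DepthIntegral

open Set

variable {W : Waveguide} {X : ℝ} {f g : Side → ℝ → ℂ}

theorem openLayer_subset_layer (s : Side) : W.openLayer s X ⊆ W.layer s X := by
  cases s <;> exact Ioo_subset_Icc_self

theorem closure_openLayer (hX : -W.H < W.h₀ X ∧ W.h₀ X < 0) (s : Side) :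
    closure (W.openLayer s X) = W.layer s X := by
  cases s
  · exact closure_Ioo hX.2.ne
  · exact closure_Ioo hX.1.ne

theorem bottom_mem_layer (hX : -W.H < W.h₀ X ∧ W.h₀ X < 0) : -W.H ∈ W.layer .below X :=
  left_mem_Icc.2 hX.1.le

theorem surface_mem_layer (hX : -W.H < W.h₀ X ∧ W.h₀ X < 0) : (0 : ℝ) ∈ W.layer .above X :=
  right_mem_Icc.2 hX.2.le

theorem interface_mem_layer (hX : -W.H < W.h₀ X ∧ W.h₀ X < 0) (s : Side) :
    W.h₀ X ∈ W.layer s X := by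
  cases s
  · exact left_mem_Icc.2 hX.2.le
  · exact right_mem_Icc.2 hX.1.le

theorem intervalIntegrable_below (hX : -W.H < W.h₀ X ∧ W.h₀ X < 0)
    (hf : ∀ s, ContinuousOn (f s) (W.layer s X)) :
    IntervalIntegrable (f .below) MeasureTheory.volume (-W.H) (W.h₀ X) :=
  (hf .below).intervalIntegrable_of_Icc hX.1.le

theorem intervalIntegrable_above (hX : -W.H < W.h₀ X ∧ W.h₀ X < 0)
    (hf : ∀ s, ContinuousOn (f s) (W.layer s X)) :
    IntervalIntegrable (f .above) MeasureTheory.volume (W.h₀ X) 0 :=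
  (hf .above).intervalIntegrable_of_Icc hX.2.le

theorem depthIntegral_add (hX : -W.H < W.h₀ X ∧ W.h₀ X < 0)
    (hf : ∀ s, ContinuousOn (f s) (W.layer s X)) (hg : ∀ s, ContinuousOn (g s) (W.layer s X)) :
    W.depthIntegral (fun s z => f s z + g s z) X = W.depthIntegral f X + W.depthIntegral g X := by
  simp only [depthIntegral]
  rw [intervalIntegral.integral_add (intervalIntegrable_below hX hf)
      (intervalIntegrable_below hX hg),
    intervalIntegral.integral_add (intervalIntegrable_above hX hf)
      (intervalIntegrable_above hX hg)]
  ring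

theorem depthIntegral_const_mul (c : ℂ) (f : Side → ℝ → ℂ) :
    W.depthIntegral (fun s z => c * f s z) X = c * W.depthIntegral f X := by
  simp only [depthIntegral, intervalIntegral.integral_const_mul, mul_add]

theorem depthIntegral_sub (hX : -W.H < W.h₀ X ∧ W.h₀ X < 0)
    (hf : ∀ s, ContinuousOn (f s) (W.layer s X)) (hg : ∀ s, ContinuousOn (g s) (W.layer s X)) :
    W.depthIntegral (fun s z => f s z - g s z) X = W.depthIntegral f X - W.depthIntegral g X := by
  have hneg := depthIntegral_const_mul (W := W) (X := X) (-1) g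
  simp only [neg_one_mul] at hneg
  simpa only [sub_eq_add_neg, hneg] using
    depthIntegral_add (g := fun s z => -g s z) hX hf fun s => (hg s).fun_neg

theorem depthIntegral_sum (hX : -W.H < W.h₀ X ∧ W.h₀ X < 0) {ι : Type*} (J : Finset ι)
    {f : ι → Side → ℝ → ℂ} (hf : ∀ i ∈ J, ∀ s, ContinuousOn (f i s) (W.layer s X)) :
    W.depthIntegral (fun s z => ∑ i ∈ J, f i s z) X = ∑ i ∈ J, W.depthIntegral (f i) X := by
  simp only [depthIntegral]
  rw [intervalIntegral.integral_finsetSum fun i hi => intervalIntegrable_below hX (hf i hi),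
    intervalIntegral.integral_finsetSum fun i hi => intervalIntegrable_above hX (hf i hi),
    Finset.sum_add_distrib]

theorem depthIntegral_congr (hX : -W.H < W.h₀ X ∧ W.h₀ X < 0)
    (h : ∀ s, ∀ z ∈ W.openLayer s X, f s z = g s z) :
    W.depthIntegral f X = W.depthIntegral g X := by
  simp only [depthIntegral]
  rw [intervalIntegral.integral_congr_Ioo_of_le hX.1.le fun z hz => h .below z hz,
    intervalIntegral.integral_congr_Ioo_of_le hX.2.le fun z hz => h .above z hz]

theorem depthIntegral_ofReal (f : Side → ℝ → ℝ) :
    W.depthIntegral (fun s z => (f s z : ℂ)) X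
      = (((∫ z in (-W.H)..(W.h₀ X), f .below z) + ∫ z in (W.h₀ X)..0, f .above z : ℝ) : ℂ) := by
  simp only [depthIntegral, intervalIntegral.integral_ofReal, Complex.ofReal_add]

theorem depthIntegral_deriv (hX : -W.H < W.h₀ X ∧ W.h₀ X < 0) {v : Side → ℝ → ℂ}
    (hv : ∀ s, ∀ z ∈ W.layer s X, ContDiffAt ℝ 1 (v s) z) :
    W.depthIntegral (fun s z => deriv (v s) z) X
      = v .above 0 - v .below (-W.H) - W.jump v X := by
  have hlayer : ∀ s a b, a ≤ b → Icc a b ⊆ W.layer s X →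
      ∫ z in a..b, deriv (v s) z = v s b - v s a := fun s a b hab hs => by
    have hv' : ∀ z ∈ uIcc a b, ContDiffAt ℝ 1 (v s) z := fun z hz =>
      hv s z (hs (uIcc_of_le hab ▸ hz))
    exact intervalIntegral.integral_deriv_eq_sub
      (fun z hz => (hv' z hz).differentiableAt one_ne_zero)
      (continuousOn_deriv_of_contDiffAt hv').intervalIntegrable
  rw [depthIntegral, hlayer .below _ _ hX.1.le subset_rfl, hlayer .above _ _ hX.2.le subset_rfl,
    jump]
  ring

theorem depthIntegral_deriv_mul (hX : -W.H < W.h₀ X ∧ W.h₀ X < 0) {v w : Side → ℝ → ℂ}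
    (hv : ∀ s, ∀ z ∈ W.layer s X, ContDiffAt ℝ 1 (v s) z)
    (hw : ∀ s, ∀ z ∈ W.layer s X, ContDiffAt ℝ 1 (w s) z) :
    W.depthIntegral (fun s z => deriv (v s) z * w s z) X
      = v .above 0 * w .above 0 - v .below (-W.H) * w .below (-W.H)
        - W.jump (fun s z => v s z * w s z) X
        - W.depthIntegral (fun s z => v s z * deriv (w s) z) X := by
  have hvc : ∀ s, ContinuousOn (v s) (W.layer s X) := fun s z hz =>
    (hv s z hz).continuousAt.continuousWithinAt
  have hwc : ∀ s, ContinuousOn (w s) (W.layer s X) := fun s z hz =>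
    (hw s z hz).continuousAt.continuousWithinAt
  rw [eq_sub_iff_add_eq,
    ← depthIntegral_add hX (fun s => (continuousOn_deriv_of_contDiffAt (hv s)).fun_mul (hwc s))
      fun s => (hvc s).fun_mul (continuousOn_deriv_of_contDiffAt (hw s)),
    ← depthIntegral_deriv (v := fun s z => v s z * w s z) hX
      fun s z hz => (hv s z hz).mul (hw s z hz)]
  refine depthIntegral_congr hX fun s z hz => ?_
  have hz' := openLayer_subset_layer s hz
  exact (deriv_fun_mul ((hv s z hz').differentiableAt one_ne_zero)
    ((hw s z hz').differentiableAt one_ne_zero)).symm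

end DepthIntegral

section Green

open Set

variable {W : Waveguide} {I : Set ℝ} {X : ℝ} {k : ℝ → ℝ} {φ : Side → ℝ → ℝ → ℝ}
  {u w : Side → ℝ → ℂ}

theorem Regular.continuousOn_γ₀ (hW : W.Regular I) (hX : X ∈ I) (s : Side) :
    ContinuousOn (fun z => (W.γ₀ s X z : ℂ)) (W.layer s X) := fun _ hz =>
  (contDiffAt_ofReal_comp (hW.contDiffAt_γ₀ hX hz)).continuousAt.continuousWithinAt

theorem Regular.continuousOn_n₀ (hW : W.Regular I) (hX : X ∈ I) (s : Side) :
    ContinuousOn (W.n₀ s X) (W.layer s X) := fun z hz =>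
  (hW.continuous_n₀ s X hX z hz).continuousWithinAt

theorem Regular.continuousOn_potential (hW : W.Regular I) (hX : X ∈ I) (κ : ℝ) (s : Side) :
    ContinuousOn (fun z => W.γ₀ s X z * (W.n₀ s X z ^ 2 - κ ^ 2)) (W.layer s X) :=
  ContinuousOn.mul (fun _ hz => (hW.contDiffAt_γ₀ hX hz).continuousAt.continuousWithinAt)
    (((hW.continuousOn_n₀ hX s).pow 2).sub continuousOn_const)

theorem Regular.contDiffAt_flux (hW : W.Regular I) (hX : X ∈ I)
    (hu : ∀ s, ∀ z ∈ W.layer s X, ContDiffAt ℝ 2 (u s) z) (s : Side) (z : ℝ)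
    (hz : z ∈ W.layer s X) : ContDiffAt ℝ 1 (fun t => (W.γ₀ s X t : ℂ) * deriv (u s) t) z :=
  (contDiffAt_ofReal_comp (hW.contDiffAt_γ₀ hX hz)).mul ((hu s z hz).derivWithin (m := 1) le_rfl)

theorem Regular.continuousOn_modeOperator (hW : W.Regular I) (hX : X ∈ I) (κ : ℝ)
    (hu : ∀ s, ∀ z ∈ W.layer s X, ContDiffAt ℝ 2 (u s) z) (s : Side) :
    ContinuousOn (W.modeOperator κ X u s) (W.layer s X) :=
  (continuousOn_deriv_of_contDiffAt (hW.contDiffAt_flux hX hu s)).add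
    ((Complex.continuous_ofReal.comp_continuousOn (hW.continuousOn_potential hX κ s)).mul
      fun z hz => (hu s z hz).continuousAt.continuousWithinAt)

theorem IsMode.contDiffAt_ofReal (hφ : W.IsMode I k φ) (hX : X ∈ I) (s : Side) (z : ℝ)
    (hz : z ∈ W.layer s X) : ContDiffAt ℝ 2 (fun t => (φ s X t : ℂ)) z :=
  contDiffAt_ofReal_comp (hφ.contDiffAt hX hz)

theorem IsMode.continuousOn_ofReal (hφ : W.IsMode I k φ) (hX : X ∈ I) (s : Side) :
    ContinuousOn (fun t => (φ s X t : ℂ)) (W.layer s X) := fun z hz =>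
  (hφ.contDiffAt_ofReal hX s z hz).continuousAt.continuousWithinAt

theorem IsMode.modeOperator_eq (hW : W.Regular I) (hφ : W.IsMode I k φ) (hX : X ∈ I) (κ : ℝ)
    {s : Side} {z : ℝ} (hz : z ∈ W.layer s X) :
    W.modeOperator κ X (fun s t => (φ s X t : ℂ)) s z
      = ((k X : ℂ) ^ 2 - (κ : ℂ) ^ 2) * (W.γ₀ s X z * φ s X z) := by
  have hopen : EqOn (W.modeOperator κ X (fun s t => (φ s X t : ℂ)) s)
      (fun z => ((k X : ℂ) ^ 2 - (κ : ℂ) ^ 2) * (W.γ₀ s X z * φ s X z)) (W.openLayer s X) := by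
    intro t ht
    have hspec := congrArg Complex.ofReal (hφ.spectral s X hX t ht)
    simp only [modeOperator, deriv_ofReal_comp, ← Complex.ofReal_mul]
    push_cast at hspec ⊢
    linear_combination hspec
  exact hopen.of_subset_closure
    (hW.continuousOn_modeOperator hX κ (hφ.contDiffAt_ofReal hX) s)
    (continuousOn_const.mul ((hW.continuousOn_γ₀ hX s).mul (hφ.continuousOn_ofReal hX s)))
    (openLayer_subset_layer s) (closure_openLayer (hW.interface X hX) s).ge hz

/-- The pairing `∫ γ₀ u w dz`, for which the modes are orthonormal. It is bilinear: there is no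
conjugation. -/
def pairing (W : Waveguide) (X : ℝ) (u w : Side → ℝ → ℂ) : ℂ :=
  W.depthIntegral (fun s z => (W.γ₀ s X z : ℂ) * u s z * w s z) X

/-- The Lagrange bracket `γ₀ (u_z w - u w_z)` of the operator `modeOperator`. -/
def lagrangeBracket (W : Waveguide) (X : ℝ) (u w : Side → ℝ → ℂ) (s : Side) (z : ℝ) : ℂ :=
  (W.γ₀ s X z : ℂ) * deriv (u s) z * w s z - u s z * ((W.γ₀ s X z : ℂ) * deriv (w s) z)

theorem depthIntegral_modeOperator_mul_sub (hW : W.Regular I) (hX : X ∈ I) (κ : ℝ)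
    (hu : ∀ s, ∀ z ∈ W.layer s X, ContDiffAt ℝ 2 (u s) z)
    (hw : ∀ s, ∀ z ∈ W.layer s X, ContDiffAt ℝ 2 (w s) z) :
    W.depthIntegral (fun s z => W.modeOperator κ X u s z * w s z) X
        - W.depthIntegral (fun s z => W.modeOperator κ X w s z * u s z) X
      = W.lagrangeBracket X u w .above 0 - W.lagrangeBracket X u w .below (-W.H)
        - W.jump (W.lagrangeBracket X u w) X := by
  have hu₁ := fun s z hz => (hu s z hz).of_le one_le_two
  have hw₁ := fun s z hz => (hw s z hz).of_le one_le_two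
  have hγu := hW.contDiffAt_flux hX hu
  have hγw := hW.contDiffAt_flux hX hw
  rw [← depthIntegral_deriv (v := W.lagrangeBracket X u w) (hW.interface X hX) fun s z hz =>
      ((hγu s z hz).mul (hw₁ s z hz)).sub ((hu₁ s z hz).mul (hγw s z hz)),
    ← depthIntegral_sub (hW.interface X hX)
      (fun s => (hW.continuousOn_modeOperator hX κ hu s).fun_mul
        fun z hz => (hw s z hz).continuousAt.continuousWithinAt)
      fun s => (hW.continuousOn_modeOperator hX κ hw s).fun_mul
        fun z hz => (hu s z hz).continuousAt.continuousWithinAt]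
  refine depthIntegral_congr (hW.interface X hX) fun s z hz => ?_
  have hz' := openLayer_subset_layer s hz
  have hasDeriv {v : ℝ → ℂ} (hv : ContDiffAt ℝ 1 v z) : HasDerivAt v (deriv v z) z :=
    (hv.differentiableAt one_ne_zero).hasDerivAt
  refine Eq.trans ?_ (((hasDeriv (hγu s z hz')).mul (hasDeriv (hw₁ s z hz'))).sub
    ((hasDeriv (hu₁ s z hz')).mul (hasDeriv (hγw s z hz')))).deriv.symm
  simp only [modeOperator]
  ring

theorem IsMode.depthIntegral_modeOperator_mul (hW : W.Regular I) (hφ : W.IsMode I k φ)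
    (hX : X ∈ I) (κ : ℝ) (hu : ∀ s, ∀ z ∈ W.layer s X, ContDiffAt ℝ 2 (u s) z)
    (hbot : deriv (u .below) (-W.H) = 0) :
    W.depthIntegral (fun s z => W.modeOperator κ X u s z * φ s X z) X
      = ((k X : ℂ) ^ 2 - (κ : ℂ) ^ 2) * W.pairing X u (fun s z => φ s X z)
        - φ .above X (W.h₀ X) * W.jump (fun s z => (W.γ₀ s X z : ℂ) * deriv (u s) z) X
        + ((W.γ₀ .above X (W.h₀ X) * deriv (φ .above X) (W.h₀ X) : ℝ) : ℂ) * W.jump u X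
        - u .above 0 * ((W.γ₀ .above X 0 * deriv (φ .above X) 0 : ℝ) : ℂ) := by
  have hlagrange := depthIntegral_modeOperator_mul_sub hW hX κ hu (hφ.contDiffAt_ofReal hX)
  have hmode : W.depthIntegral
      (fun s z => W.modeOperator κ X (fun s t => (φ s X t : ℂ)) s z * u s z) X
      = ((k X : ℂ) ^ 2 - (κ : ℂ) ^ 2) * W.pairing X u (fun s z => φ s X z) := by
    rw [pairing, ← depthIntegral_const_mul]
    refine depthIntegral_congr (hW.interface X hX) fun s z hz => ?_
    rw [hφ.modeOperator_eq hW hX κ (openLayer_subset_layer s hz)]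
    ring
  rw [hmode] at hlagrange
  simp only [lagrangeBracket, jump, hbot, deriv_ofReal_comp, ← Complex.ofReal_mul,
    hφ.bottom X hX, hφ.surface X hX, ← hφ.continuous X hX, ← hφ.continuous_flux X hX,
    Complex.ofReal_zero, mul_zero] at hlagrange ⊢
  linear_combination hlagrange

end Green

section Orthonormality

variable {W : Waveguide} {I : Set ℝ} {X : ℝ} {k₁ k₂ : ℝ → ℝ} {φ ψ : Side → ℝ → ℝ → ℝ}

theorem pairing_comm (u w : Side → ℝ → ℂ) : W.pairing X u w = W.pairing X w u := by
  simp only [pairing, mul_right_comm _ (u _ _)]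

theorem IsMode.pairing_self (hφ : W.IsMode I k₁ φ) (hX : X ∈ I) :
    W.pairing X (fun s z => φ s X z) (fun s z => φ s X z) = 1 := by
  simp only [pairing, ← Complex.ofReal_mul]
  rw [depthIntegral_ofReal fun s z => W.γ₀ s X z * φ s X z * φ s X z, ← Complex.ofReal_one,
    ← hφ.normalized X hX]
  simp only [mul_assoc, pow_two]

theorem IsMode.sq_sub_sq_ne_zero (hφ : W.IsMode I k₁ φ) (hψ : W.IsMode I k₂ ψ) (hX : X ∈ I)
    (hne : k₁ X ≠ k₂ X) : (k₁ X : ℂ) ^ 2 - (k₂ X : ℂ) ^ 2 ≠ 0 := by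
  exact_mod_cast sub_ne_zero.2 fun h =>
    hne ((pow_left_inj₀ (hφ.pos X hX).le (hψ.pos X hX).le two_ne_zero).1 h)

theorem IsMode.jump_eq_zero (hφ : W.IsMode I k₁ φ) (hX : X ∈ I) :
    W.jump (fun s z => (φ s X z : ℂ)) X = 0 := by
  rw [jump, hφ.continuous X hX, sub_self]

theorem IsMode.jump_flux_eq_zero (hφ : W.IsMode I k₁ φ) (hX : X ∈ I) :
    W.jump (fun s z => (W.γ₀ s X z : ℂ) * ((deriv (φ s X) z : ℝ) : ℂ)) X = 0 := by
  simp only [jump, ← Complex.ofReal_mul, hφ.continuous_flux X hX, sub_self]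

theorem IsMode.pairing_eq_zero (hW : W.Regular I) (hφ : W.IsMode I k₁ φ) (hψ : W.IsMode I k₂ ψ)
    (hX : X ∈ I) (hne : k₁ X ≠ k₂ X) :
    W.pairing X (fun s z => φ s X z) (fun s z => ψ s X z) = 0 := by
  have hgreen := hψ.depthIntegral_modeOperator_mul hW hX (k₁ X) (hφ.contDiffAt_ofReal hX)
    (by rw [deriv_ofReal_comp, hφ.bottom X hX, Complex.ofReal_zero])
  have hmode : W.depthIntegral (fun s z =>
      W.modeOperator (k₁ X) X (fun s t => (φ s X t : ℂ)) s z * ψ s X z) X = 0 := by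
    rw [depthIntegral_congr (g := fun _ _ => 0) (hW.interface X hX) fun s z hz => by
      rw [hφ.modeOperator_eq hW hX _ (openLayer_subset_layer s hz), sub_self, zero_mul, zero_mul]]
    simp [depthIntegral]
  simp only [deriv_ofReal_comp] at hgreen
  rw [hmode, hφ.jump_flux_eq_zero hX, hφ.jump_eq_zero hX, hφ.surface X hX] at hgreen
  refine (mul_eq_zero.1 ?_).resolve_left (hψ.sq_sub_sq_ne_zero hφ hX hne.symm)
  simpa using hgreen.symm

end Orthonormality

section DerivPairing

open Set

variable {W : Waveguide} {I : Set ℝ} {X : ℝ}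

theorem Regular.hasDerivAt_depthIntegral (hW : W.Regular I) (hX : X ∈ I)
    {f : Side → ℝ → ℝ → ℂ}
    (hf : ∀ s, ∀ z ∈ W.layer s X, ContDiffAt ℝ 1 (fun p : ℝ × ℝ => f s p.1 p.2) (X, z)) :
    HasDerivAt (fun x => W.depthIntegral (fun s z => f s x z) x)
      (W.depthIntegral (fun s z => deriv (fun t => f s t z) X) X
        - deriv W.h₀ X * W.jump (fun s z => f s X z) X) X := by
  have hlt := hW.interface X hX
  have hh₀ := (hW.differentiable_h₀ X hX).hasDerivAt
  have hbelow := hasDerivAt_integral_moving_right (f := f .below) (a := -W.H)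
    (fun z hz => hf .below z (by rwa [uIcc_of_le hlt.1.le] at hz)) hh₀
  have habove := hasDerivAt_integral_moving_right (f := f .above) (a := 0)
    (fun z hz => hf .above z (by rwa [uIcc_of_ge hlt.2.le] at hz)) hh₀
  simp only [depthIntegral, intervalIntegral.integral_symm 0]
  refine (hbelow.add habove.neg).congr_deriv ?_
  simp only [jump, Complex.real_smul]
  ring

theorem Regular.hasDerivAt_pairing (hW : W.Regular I) (hX : X ∈ I) {u w : Side → ℝ → ℝ → ℂ}
    (hu : ∀ s, ∀ z ∈ W.layer s X, ContDiffAt ℝ 1 (fun p : ℝ × ℝ => u s p.1 p.2) (X, z))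
    (hw : ∀ s, ∀ z ∈ W.layer s X, ContDiffAt ℝ 1 (fun p : ℝ × ℝ => w s p.1 p.2) (X, z)) :
    HasDerivAt (fun x => W.pairing x (fun s z => u s x z) fun s z => w s x z)
      (W.depthIntegral (fun s z =>
          ((deriv (fun t => W.γ₀ s t z) X : ℝ) : ℂ) * u s X z * w s X z) X
        + W.pairing X (fun s z => deriv (fun t => u s t z) X) (fun s z => w s X z)
        + W.pairing X (fun s z => u s X z) (fun s z => deriv (fun t => w s t z) X)
        - deriv W.h₀ X * W.jump (fun s z => W.γ₀ s X z * u s X z * w s X z) X) X := by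
  have hlt := hW.interface X hX
  have hγ s z (hz : z ∈ W.layer s X) := contDiffAt_ofReal_comp (hW.smooth_γ₀ s X hX z hz)
  have hasDeriv {f : ℝ → ℝ → ℂ} {z : ℝ}
      (hf : ContDiffAt ℝ 1 (fun p : ℝ × ℝ => f p.1 p.2) (X, z)) :
      HasDerivAt (fun t => f t z) (deriv (fun t => f t z) X) X :=
    ((contDiffAt_of_uncurry_left hf).differentiableAt one_ne_zero).hasDerivAt
  refine (hW.hasDerivAt_depthIntegral hX (f := fun s x z => W.γ₀ s x z * u s x z * w s x z)
    fun s z hz => ((hγ s z hz).mul (hu s z hz)).mul (hw s z hz)).congr_deriv ?_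
  congr 1
  have cγ s := hW.continuousOn_γ₀ hX s
  have cγ' s := continuousOn_deriv_uncurry_left (hW.smooth_γ₀ s X hX)
  have cu s := continuousOn_of_uncurry_right (hu s)
  have cu' s := continuousOn_deriv_uncurry_left (hu s)
  have cw s := continuousOn_of_uncurry_right (hw s)
  have cw' s := continuousOn_deriv_uncurry_left (hw s)
  rw [pairing, pairing, ← depthIntegral_add hlt (fun s => by fun_prop) (fun s => by fun_prop),
    ← depthIntegral_add hlt (fun s => by fun_prop) (fun s => by fun_prop)]
  refine depthIntegral_congr hlt fun s z hz => ?_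
  have hz' := openLayer_subset_layer s hz
  refine (((hasDeriv (f := fun x z => (W.γ₀ s x z : ℂ)) (hγ s z hz')).mul
    (hasDeriv (hu s z hz'))).mul (hasDeriv (hw s z hz'))).deriv.trans ?_
  rw [deriv_ofReal_comp fun t => W.γ₀ s t z]
  simp only [Pi.mul_apply]
  ring

/-- The `C`-terms and the term with `h₀'` come from differentiating in `X` the constant overlap of
two modes. -/
theorem IsMode.depthIntegral_deriv_γ₀_mul (hI : IsOpen I) (hW : W.Regular I) {k : ℕ → ℝ → ℝ}
    {φ : ℕ → Side → ℝ → ℝ → ℝ} {j l : ℕ} (hj : W.IsMode I (k j) (φ j))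
    (hl : W.IsMode I (k l) (φ l)) (hX : X ∈ I) {δ : ℂ}
    (hδ : ∀ x ∈ I, W.pairing x (fun s z => φ j s x z) (fun s z => φ l s x z) = δ) :
    W.depthIntegral (fun s z =>
        ((deriv (fun t => W.γ₀ s t z) X : ℝ) : ℂ) * φ j s X z * φ l s X z) X
      = deriv W.h₀ X * φ j .above X (W.h₀ X) * φ l .above X (W.h₀ X)
          * W.jump (fun s z => (W.γ₀ s X z : ℂ)) X - W.C φ j l X - W.C φ l j X := by
  have hC (i m : ℕ) : W.C φ i m X = W.pairing X (fun s z => deriv (fun t => (φ i s t z : ℂ)) X)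
      (fun s z => φ m s X z) := by
    simp only [C, pairing, Complex.ofReal_mul, deriv_ofReal_comp fun t => φ i _ t _]
  have hsmooth {i : ℕ} (hi : W.IsMode I (k i) (φ i)) (s z) (hz : z ∈ W.layer s X) :
      ContDiffAt ℝ 1 (fun p : ℝ × ℝ => (φ i s p.1 p.2 : ℂ)) (X, z) :=
    (contDiffAt_ofReal_comp (hi.smooth s X hX z hz)).of_le one_le_two
  have hderiv := (hW.hasDerivAt_pairing hX (hsmooth hj) (hsmooth hl)).unique
    ((hasDerivAt_const X δ).congr_of_eventuallyEq ((hI.eventually_mem hX).mono hδ))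
  rw [pairing_comm fun s z => (φ j s X z : ℂ), ← hC, ← hC] at hderiv
  simp only [jump, ← hj.continuous X hX, ← hl.continuous X hX] at hderiv ⊢
  linear_combination hderiv

end DerivPairing

section SourceProjection

variable {W : Waveguide} {I : Set ℝ} {X : ℝ} {k : ℕ → ℝ → ℝ} {φ : ℕ → Side → ℝ → ℝ → ℝ} {j l : ℕ}

/-- The jump of `u₁` at `z = h₀` prescribed by the leading term `A φ`. -/
def valueJump (W : Waveguide) (φ : Side → ℝ → ℝ → ℝ) (A : ℝ → ℝ → ℂ) (X Y : ℝ) : ℂ :=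
  -(W.h₁ X Y * A X Y * W.jump (fun s z => ((deriv (φ s X) z : ℝ) : ℂ)) X)

/-- The jump of `γ₀ u_{1z}` at `z = h₀` prescribed by the leading term `A φ`. -/
def fluxJump (W : Waveguide) (k : ℝ → ℝ) (φ : Side → ℝ → ℝ → ℝ) (A : ℝ → ℝ → ℂ) (X Y : ℝ) : ℂ :=
  Complex.I * k X * ((deriv W.h₀ X : ℝ) : ℂ) * A X Y * φ .above X (W.h₀ X)
      * W.jump (fun s z => (W.γ₀ s X z : ℂ)) X
    - A X Y * W.jump (fun s z => ((W.γ₁ s X Y z * deriv (φ s X) z : ℝ) : ℂ)) X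
    - W.h₁ X Y * A X Y * W.jump
        (fun s z => ((deriv (fun t => W.γ₀ s X t * deriv (φ s X) t) z : ℝ) : ℂ)) X

theorem Regular.contDiffAt_γ₁_mul_deriv (hW : W.Regular I) (hj : W.IsMode I (k j) (φ j))
    (hX : X ∈ I) (Y : ℝ) (s : Side) (z : ℝ) (hz : z ∈ W.layer s X) :
    ContDiffAt ℝ 1 (fun t => W.γ₁ s X Y t * deriv (φ j s X) t) z :=
  (hW.smooth_γ₁ s X hX Y z hz).mul ((hj.contDiffAt hX hz).derivWithin (m := 1) le_rfl)

theorem depthIntegral_source_mul_eq_add (hW : W.Regular I) (hj : W.IsMode I (k j) (φ j))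
    (hl : W.IsMode I (k l) (φ l)) (A : ℝ → ℝ → ℂ) (hX : X ∈ I) (Y : ℝ) :
    W.depthIntegral (fun s z => W.source (k j) (φ j) A X Y s z * φ l s X z) X
      = A X Y * W.depthIntegral (fun s z =>
            ((deriv (fun t => W.γ₁ s X Y t * deriv (φ j s X) t) z : ℝ) : ℂ) * φ l s X z) X
        + A X Y * W.depthIntegral (fun s z =>
            ((W.γ₁ s X Y z * (W.n₀ s X z ^ 2 - k j X ^ 2) * φ j s X z * φ l s X z : ℝ) : ℂ)) X
        + A X Y * W.depthIntegral (fun s z =>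
            W.γ₀ s X z * W.ν s X Y z * φ j s X z * φ l s X z) X
        + (2 * Complex.I * k j X * deriv (fun t => A t Y) X
            + Complex.I * ((deriv (k j) X : ℝ) : ℂ) * A X Y + iteratedDeriv 2 (A X) Y)
          * W.pairing X (fun s z => φ j s X z) (fun s z => φ l s X z)
        + Complex.I * k j X * A X Y * W.depthIntegral (fun s z =>
            ((deriv (fun t => W.γ₀ s t z) X : ℝ) : ℂ) * φ j s X z * φ l s X z) X
        + 2 * (Complex.I * k j X * A X Y) * W.C φ j l X := by
  have hlt := hW.interface X hX
  have cφj s := continuousOn_of_uncurry_right fun z hz =>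
    (hj.smooth s X hX z hz).of_le one_le_two
  have cφl s := continuousOn_of_uncurry_right fun z hz =>
    (hl.smooth s X hX z hz).of_le one_le_two
  have cφjX s := continuousOn_deriv_uncurry_left fun z hz =>
    (hj.smooth s X hX z hz).of_le one_le_two
  have cγ₀ s := continuousOn_of_uncurry_right (hW.smooth_γ₀ s X hX)
  have cγ₀X s := continuousOn_deriv_uncurry_left (hW.smooth_γ₀ s X hX)
  have cγ₁ : ∀ s, ContinuousOn (W.γ₁ s X Y) (W.layer s X) := fun s z hz =>
    (hW.smooth_γ₁ s X hX Y z hz).continuousAt.continuousWithinAt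
  have cγ₁φj s := continuousOn_deriv_of_contDiffAt (hW.contDiffAt_γ₁_mul_deriv hj hX Y s)
  have cn₀ := hW.continuousOn_n₀ hX
  have cν : ∀ s, ContinuousOn (W.ν s X Y) (W.layer s X) := fun s z hz =>
    (hW.continuous_ν s X hX Y z hz).continuousWithinAt
  rw [pairing, C]
  simp only [← depthIntegral_const_mul]
  rw [← depthIntegral_add hlt, ← depthIntegral_add hlt, ← depthIntegral_add hlt,
    ← depthIntegral_add hlt, ← depthIntegral_add hlt]
  · refine depthIntegral_congr hlt fun s z _ => ?_
    simp only [source]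
    push_cast
    ring
  all_goals
    intro s
    fun_prop

theorem Regular.continuousOn_source (hW : W.Regular I) (hj : W.IsMode I (k j) (φ j))
    (A : ℝ → ℝ → ℂ) (hX : X ∈ I) (Y : ℝ) (s : Side) :
    ContinuousOn (W.source (k j) (φ j) A X Y s) (W.layer s X) := by
  have hφ z (hz : z ∈ W.layer s X) := (hj.smooth s X hX z hz).of_le one_le_two
  have cφ := continuousOn_of_uncurry_right hφ
  have cφX := continuousOn_deriv_uncurry_left hφ
  have cγ₀ := continuousOn_of_uncurry_right (hW.smooth_γ₀ s X hX)
  have cγ₀X := continuousOn_deriv_uncurry_left (hW.smooth_γ₀ s X hX)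
  have cγ₁ : ContinuousOn (W.γ₁ s X Y) (W.layer s X) := fun z hz =>
    (hW.smooth_γ₁ s X hX Y z hz).continuousAt.continuousWithinAt
  have cγ₁φ := continuousOn_deriv_of_contDiffAt (hW.contDiffAt_γ₁_mul_deriv hj hX Y s)
  have cn₀ := hW.continuousOn_n₀ hX s
  have cν : ContinuousOn (W.ν s X Y) (W.layer s X) := fun z hz =>
    (hW.continuous_ν s X hX Y z hz).continuousWithinAt
  unfold source
  fun_prop

theorem depthIntegral_deriv_γ₁_mul (hW : W.Regular I) (hj : W.IsMode I (k j) (φ j))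
    (hl : W.IsMode I (k l) (φ l)) (hX : X ∈ I) (Y : ℝ) :
    W.depthIntegral (fun s z =>
        ((deriv (fun t => W.γ₁ s X Y t * deriv (φ j s X) t) z : ℝ) : ℂ) * φ l s X z) X
      = -(φ l .above X (W.h₀ X)
          * W.jump (fun s z => ((W.γ₁ s X Y z * deriv (φ j s X) z : ℝ) : ℂ)) X)
        - W.depthIntegral (fun s z =>
          ((W.γ₁ s X Y z * deriv (φ j s X) z * deriv (φ l s X) z : ℝ) : ℂ)) X := by
  have hparts := depthIntegral_deriv_mul (hW.interface X hX)
    (fun s z hz => contDiffAt_ofReal_comp (hW.contDiffAt_γ₁_mul_deriv hj hX Y s z hz))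
    (fun s z hz => (hl.contDiffAt_ofReal hX s z hz).of_le one_le_two)
  simp only [deriv_ofReal_comp] at hparts
  rw [hparts, hl.surface X hX, hj.bottom X hX]
  simp only [jump, ← hl.continuous X hX]
  push_cast
  ring

theorem IsMode.jump_deriv (hW : W.Regular I) (hj : W.IsMode I (k j) (φ j)) (hX : X ∈ I) :
    W.jump (fun s z => ((deriv (φ j s X) z : ℝ) : ℂ)) X
      = W.γ₀ .above X (W.h₀ X) * ((deriv (φ j .above X) (W.h₀ X) : ℝ) : ℂ)
        * W.jump (fun s z => ((1 / W.γ₀ s X z : ℝ) : ℂ)) X := by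
  have hne (s : Side) : W.γ₀ s X (W.h₀ X) ≠ 0 :=
    (hW.pos_γ₀ s X hX _ (interface_mem_layer (hW.interface X hX) s)).ne'
  have habove := hne .above
  have hbelow := hne .below
  simp only [jump]
  norm_cast
  field_simp
  linear_combination hj.continuous_flux X hX

theorem depthIntegral_source_mul (hI : IsOpen I) (hW : W.Regular I) (hj : W.IsMode I (k j) (φ j))
    (hl : W.IsMode I (k l) (φ l)) {δ : ℂ}
    (hδ : ∀ x ∈ I, W.pairing x (fun s z => φ j s x z) (fun s z => φ l s x z) = δ)
    (A : ℝ → ℝ → ℂ) (hX : X ∈ I) (Y : ℝ) :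
    W.depthIntegral (fun s z => W.source (k j) (φ j) A X Y s z * φ l s X z) X
      - φ l .above X (W.h₀ X) * W.fluxJump (k j) (φ j) A X Y
      + ((W.γ₀ .above X (W.h₀ X) * deriv (φ l .above X) (W.h₀ X) : ℝ) : ℂ)
          * W.valueJump (φ j) A X Y
      = δ * (2 * Complex.I * k j X * deriv (fun t => A t Y) X
          + Complex.I * ((deriv (k j) X : ℝ) : ℂ) * A X Y + iteratedDeriv 2 (A X) Y)
        + W.α k φ l j X Y * A X Y := by
  rw [depthIntegral_source_mul_eq_add hW hj hl A hX Y, depthIntegral_deriv_γ₁_mul hW hj hl hX Y,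
    hj.depthIntegral_deriv_γ₀_mul hI hW hl hX hδ, hδ X hX, fluxJump, valueJump,
    hj.jump_deriv hW hX, Complex.ofReal_mul (W.γ₀ .above X (W.h₀ X)), α]
  ring

end SourceProjection

section Interface

variable {W : Waveguide} {I : Set ℝ} {X Y : ℝ} {k : ℝ → ℝ} {φ : Side → ℝ → ℝ → ℝ} {A : ℝ → ℝ → ℂ}
  {u : Side → Expansion}

theorem coeff_one_trace_eq_iff
    (hu : ∀ s, PowerSeries.coeff 0 (u s) = fun X Y z => A X Y * (φ s X z : ℂ)) :
    PowerSeries.coeff 1 (W.trace (u .above)) X Y = PowerSeries.coeff 1 (W.trace (u .below)) X Y ↔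
      W.jump (fun s => PowerSeries.coeff 1 (u s) X Y) X = W.valueJump φ A X Y := by
  simp only [coeff_one_trace, hu, deriv_const_mul_field, deriv_ofReal_comp, jump, valueJump]
  constructor <;> intro h <;> linear_combination h

theorem deriv_coeff_zero_flux (θ : ℝ → ℝ) {s : Side}
    (hu : PowerSeries.coeff 0 (u s) = fun X Y z => A X Y * (φ s X z : ℂ)) (z : ℝ) :
    deriv (PowerSeries.coeff 0 (W.flux s θ (u s)) X Y) z
      = A X Y * ((deriv (fun t => W.γ₀ s X t * deriv (φ s X) t) z : ℝ) : ℂ) := by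
  rw [coeff_zero_flux, hu, ← deriv_ofReal_comp, ← deriv_const_mul_field]
  congr 1
  funext t
  simp only [Pi.mul_apply, dZ, deriv_const_mul_field, deriv_ofReal_comp, Complex.ofReal_mul]
  ring

theorem coeff_one_trace_flux_eq_iff (hW : W.Regular I) (hφ : W.IsMode I k φ) {θ : ℝ → ℝ}
    (hX : X ∈ I) (hθ : HasDerivAt θ (k X) X)
    (hu : ∀ s, PowerSeries.coeff 0 (u s) = fun X Y z => A X Y * (φ s X z : ℂ)) :
    PowerSeries.coeff 1 (W.trace (W.flux .above θ (u .above))) X Y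
        = PowerSeries.coeff 1 (W.trace (W.flux .below θ (u .below))) X Y ↔
      W.jump (fun s z => (W.γ₀ s X z : ℂ) * deriv (PowerSeries.coeff 1 (u s) X Y) z) X
        = W.fluxJump k φ A X Y := by
  simp only [coeff_one_trace, coeff_one_flux _ _ _ _ (hW.differentiable_h₀ X hX),
    deriv_coeff_zero_flux _ (hu _), hu, deriv_const_mul_field, deriv_ofReal_comp, hθ.deriv, jump,
    fluxJump, ← hφ.continuous X hX]
  push_cast
  constructor <;> intro h <;> linear_combination h

end Interface

section Transmission

variable {W : Waveguide} {I : Set ℝ} {X : ℝ}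

/-- The conditions on a component of `u₁` apart from the equation and the surface condition: it is
smooth in each closed layer, satisfies the bottom condition, and `u` and `γ₀ u_z` have the jumps
`a` and `b` at the interface. -/
structure IsTransmission (W : Waveguide) (X : ℝ) (a b : ℂ) (u : Side → ℝ → ℂ) : Prop where
  contDiffAt : ∀ s, ∀ z ∈ W.layer s X, ContDiffAt ℝ 2 (u s) z
  bottom : deriv (u .below) (-W.H) = 0
  jump_eq : W.jump u X = a
  jump_flux_eq : W.jump (fun s z => (W.γ₀ s X z : ℂ) * deriv (u s) z) X = b

theorem exists_isTransmission_modeOperator_eq (hW : W.Regular I) (hX : X ∈ I) (κ : ℝ)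
    {g : Side → ℝ → ℂ} (hg : ∀ s, ContinuousOn (g s) (W.layer s X)) (a b : ℂ) :
    ∃ u, W.IsTransmission X a b u ∧
      ∀ s, ∀ z ∈ W.layer s X, W.modeOperator κ X u s z = g s z := by
  have hlt := hW.interface X hX
  have hγ₀ s z (hz : z ∈ W.layer s X) : W.γ₀ s X z ≠ 0 := (hW.pos_γ₀ s X hX z hz).ne'
  obtain ⟨v, hv, -, hv_bot, hv_eq⟩ := exists_sturmLiouville_initialValue hlt.1.le
    (fun _ => hW.contDiffAt_γ₀ hX (s := .below)) (hγ₀ .below)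
    (hW.continuousOn_potential hX κ .below) (hg .below) 0 0
  obtain ⟨w, hw, hw_value, hw_flux, hw_eq⟩ := exists_sturmLiouville_initialValue hlt.2.le
    (fun _ => hW.contDiffAt_γ₀ hX (s := .above)) (hγ₀ .above)
    (hW.continuousOn_potential hX κ .above) (hg .above) (v (W.h₀ X) + a)
    ((W.γ₀ .below X (W.h₀ X) : ℂ) * deriv v (W.h₀ X) + b)
  simp only [Complex.real_smul] at hv_eq hw_eq hw_flux
  refine ⟨fun | .above => w | .below => v, ⟨?_, ?_, ?_, ?_⟩, ?_⟩
  · rintro (_ | _)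
    exacts [hw, hv]
  · exact (smul_eq_zero.1 hv_bot).resolve_left (hγ₀ .below _ (bottom_mem_layer hlt))
  · simp only [jump, hw_value, add_sub_cancel_left]
  · simp only [jump, hw_flux, add_sub_cancel_left]
  · rintro (_ | _)
    exacts [hw_eq, hv_eq]

end Transmission

section SurfaceDerivative

open Set

variable {W : Waveguide} {I : Set ℝ} {X : ℝ} {k : ℝ → ℝ} {φ : Side → ℝ → ℝ → ℝ}

theorem IsMode.eqOn_zero_layer (hW : W.Regular I) (hφ : W.IsMode I k φ) (hX : X ∈ I) {s : Side}
    {a b c : ℝ} (hs : W.layer s X = Icc a b) (hc : c = a ∨ c = b) (hφc : φ s X c = 0)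
    (hφc' : deriv (φ s X) c = 0) : EqOn (φ s X) 0 (W.layer s X) := by
  have hγ z (hz : z ∈ W.layer s X) := hW.contDiffAt_γ₀ hX hz
  have hγ₀ z (hz : z ∈ W.layer s X) : W.γ₀ s X z ≠ 0 := (hW.pos_γ₀ s X hX z hz).ne'
  have hq := hW.continuousOn_potential hX (k X) s
  have hφ₂ := hφ.contDiffAt_ofReal hX s
  have heq : ∀ z ∈ W.layer s X, deriv (fun t => W.γ₀ s X t • deriv (fun r => (φ s X r : ℂ)) t) z
      + (W.γ₀ s X z * (W.n₀ s X z ^ 2 - k X ^ 2)) • (φ s X z : ℂ) = 0 := fun z hz => by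
    simpa only [modeOperator, Complex.real_smul, sub_self, zero_mul]
      using hφ.modeOperator_eq hW hX (k X) hz
  rw [hs] at hγ hγ₀ hq hφ₂ heq ⊢
  have hzero := eqOn_zero_of_sturmLiouville hγ hγ₀ hq hφ₂ heq hc (by simp [hφc])
    (by rw [deriv_ofReal_comp, hφc', Complex.ofReal_zero])
  exact fun z hz => Complex.ofReal_eq_zero.1 (hzero hz)

theorem IsMode.eqOn_zero_below (hW : W.Regular I) (hφ : W.IsMode I k φ) (hX : X ∈ I)
    (habove : EqOn (φ .above X) 0 (W.layer .above X)) :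
    EqOn (φ .below X) 0 (W.layer .below X) := by
  have hlt := hW.interface X hX
  have hderiv : EqOn (deriv (φ .above X)) 0 (W.openLayer .above X) := fun z hz => by
    have hlocal : φ .above X =ᶠ[nhds z] fun _ => 0 :=
      (isOpen_Ioo.eventually_mem hz).mono fun t ht => habove (openLayer_subset_layer .above ht)
    rw [hlocal.deriv_eq, deriv_const, Pi.zero_apply]
  have habove' : deriv (φ .above X) (W.h₀ X) = 0 :=
    hderiv.of_subset_closure
      (continuousOn_deriv_of_contDiffAt fun z hz => (hφ.contDiffAt hX hz).of_le one_le_two)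
      continuousOn_const (openLayer_subset_layer .above) (closure_openLayer hlt .above).ge
      (interface_mem_layer hlt .above)
  have hflux := hφ.continuous_flux X hX
  rw [habove', mul_zero, eq_comm, mul_eq_zero] at hflux
  exact hφ.eqOn_zero_layer hW hX rfl (Or.inr rfl)
    ((hφ.continuous X hX).symm.trans (habove (interface_mem_layer hlt .above)))
    (hflux.resolve_left (hW.pos_γ₀ .below X hX _ (interface_mem_layer hlt .below)).ne')

theorem IsMode.deriv_surface_ne_zero (hW : W.Regular I) (hφ : W.IsMode I k φ) (hX : X ∈ I) :
    deriv (φ .above X) 0 ≠ 0 := by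
  intro hsurface
  have habove := hφ.eqOn_zero_layer hW hX (s := .above) rfl (Or.inr rfl) (hφ.surface X hX) hsurface
  have hzero : ∀ s, EqOn (φ s X) 0 (W.layer s X) := by
    rintro (_ | _)
    exacts [habove, hφ.eqOn_zero_below hW hX habove]
  have hnorm := hφ.pairing_self hX
  rw [pairing, depthIntegral_congr (g := fun _ _ => 0) (hW.interface X hX) fun s z hz => by
    rw [hzero s (openLayer_subset_layer s hz), Pi.zero_apply, Complex.ofReal_zero, mul_zero]]
    at hnorm
  simp [depthIntegral] at hnorm

end SurfaceDerivative

section Phase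

theorem exp_phase_sub_mul (ε : ℝ) (a b : ℂ) :
    Complex.exp (Complex.I / ε * (a - b)) * Complex.exp (Complex.I / ε * b)
      = Complex.exp (Complex.I / ε * a) := by
  rw [← Complex.exp_add]
  ring_nf

theorem norm_exp_phase (ε a b : ℝ) : ‖Complex.exp (Complex.I / ε * (a - b))‖ = 1 := by
  convert Complex.norm_exp_ofReal_mul_I ((a - b) / ε) using 2
  push_cast
  ring_nf

theorem norm_sq_sub_sq_le {a b ε : ℝ} (hadd : 0 ≤ a + b) (hsub : |a - b| ≤ ε) :
    ‖(a : ℂ) ^ 2 - (b : ℂ) ^ 2‖ ≤ ε * (a + b) := by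
  have hfactor : (a : ℂ) ^ 2 - (b : ℂ) ^ 2 = (((a - b) * (a + b) : ℝ) : ℂ) := by
    push_cast
    ring
  rw [hfactor, Complex.norm_real, norm_mul, Real.norm_eq_abs, Real.norm_of_nonneg hadd]
  gcongr

end Phase

section ModeFamily

variable {W : Waveguide} {I : Set ℝ} {X : ℝ} {J : Finset ℕ} {ε : ℝ} {k : ℕ → ℝ → ℝ}
  {φ : ℕ → Side → ℝ → ℝ → ℝ} {θ : ℕ → ℝ → ℝ} {A : ℕ → ℝ → ℝ → ℂ} {j l : ℕ}

/-- A finite family of modes with pairwise distinct wavenumbers. -/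
structure IsModeFamily (W : Waveguide) (I : Set ℝ) (J : Finset ℕ) (k : ℕ → ℝ → ℝ)
    (φ : ℕ → Side → ℝ → ℝ → ℝ) : Prop where
  isMode : ∀ j ∈ J, W.IsMode I (k j) (φ j)
  distinct : ∀ X ∈ I, ∀ j ∈ J, ∀ l ∈ J, k j X = k l X → j = l

theorem IsModeFamily.pairing_eq_ite (hφ : W.IsModeFamily I J k φ) (hW : W.Regular I)
    (hj : j ∈ J) (hl : l ∈ J) (hX : X ∈ I) :
    W.pairing X (fun s z => φ j s X z) (fun s z => φ l s X z) = if j = l then 1 else 0 := by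
  split_ifs with h
  · subst h
    exact (hφ.isMode j hj).pairing_self hX
  · exact (hφ.isMode j hj).pairing_eq_zero hW (hφ.isMode l hl) hX
      fun hk => h (hφ.distinct X hX j hj l hl hk)

theorem IsModeFamily.depthIntegral_sum_mul (hφ : W.IsModeFamily I J k φ) (hW : W.Regular I)
    (hl : l ∈ J) (hX : X ∈ I) (c : ℕ → ℂ) :
    W.depthIntegral (fun s z => (∑ m ∈ J, c m * (W.γ₀ s X z * φ m s X z)) * φ l s X z) X
      = c l := by
  have hγ₀ := hW.continuousOn_γ₀ hX
  have hφl := (hφ.isMode l hl).continuousOn_ofReal hX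
  have hterm (m : ℕ) (hm : m ∈ J) (s : Side) : ContinuousOn
      (fun z => c m * ((W.γ₀ s X z : ℂ) * φ m s X z * φ l s X z)) (W.layer s X) := by
    have hφm := (hφ.isMode m hm).continuousOn_ofReal hX s
    fun_prop
  calc W.depthIntegral (fun s z => (∑ m ∈ J, c m * (W.γ₀ s X z * φ m s X z)) * φ l s X z) X
    _ = ∑ m ∈ J, c m * W.pairing X (fun s z => φ m s X z) (fun s z => φ l s X z) := by
      simp only [Finset.sum_mul, mul_assoc (c _), pairing, ← depthIntegral_const_mul]
      exact depthIntegral_sum (hW.interface X hX) J hterm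
    _ = ∑ m ∈ J, c m * if m = l then 1 else 0 :=
      Finset.sum_congr rfl fun m hm => by rw [hφ.pairing_eq_ite hW hm hl hX]
    _ = c l := by simp [hl]

/-- The part of the `l`-th mode parabolic equation generated by the `j`-th amplitude, the phase
factor being divided out. -/
def coupling (W : Waveguide) (k : ℕ → ℝ → ℝ) (φ : ℕ → Side → ℝ → ℝ → ℝ) (A : ℕ → ℝ → ℝ → ℂ)
    (l j : ℕ) (X Y : ℝ) : ℂ :=
  (if j = l then 1 else 0) * (2 * Complex.I * k j X * deriv (fun t => A j t Y) X
      + Complex.I * ((deriv (k j) X : ℝ) : ℂ) * A j X Y + iteratedDeriv 2 (A j X) Y)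
    + W.α k φ l j X Y * A j X Y

theorem sum_coupling_mul_exp (hl : l ∈ J) (X Y : ℝ) :
    ∑ j ∈ J, W.coupling k φ A l j X Y * Complex.exp (Complex.I / ε * θ j X)
      = W.mpe J ε θ k φ A l X Y * Complex.exp (Complex.I / ε * θ l X) := by
  rw [← Finset.add_sum_erase J _ hl, mpe, add_mul _ (∑ j ∈ J.erase l, _), Finset.sum_mul]
  congr 1
  · simp only [coupling, if_true, one_mul]
  · refine Finset.sum_congr rfl fun j hj => ?_
    rw [mul_assoc, exp_phase_sub_mul, coupling, if_neg (Finset.ne_of_mem_erase hj), zero_mul,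
      zero_add]

theorem IsModeFamily.depthIntegral_component_mul (hφ : W.IsModeFamily I J k φ) (hI : IsOpen I)
    (hW : W.Regular I) (hj : j ∈ J) (hl : l ∈ J) (hX : X ∈ I) (Y : ℝ) {u : Side → ℝ → ℂ}
    (hu : W.IsTransmission X (W.valueJump (φ j) (A j) X Y) (W.fluxJump (k j) (φ j) (A j) X Y) u) :
    W.depthIntegral (fun s z => (W.modeOperator (k j X) X u s z
        + W.source (k j) (φ j) (A j) X Y s z) * φ l s X z) X
      = ((k l X : ℂ) ^ 2 - (k j X : ℂ) ^ 2) * W.pairing X u (fun s z => φ l s X z)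
        + W.coupling k φ A l j X Y
        - u .above 0 * ((W.γ₀ .above X 0 * deriv (φ l .above X) 0 : ℝ) : ℂ) := by
  have hφj := hφ.isMode j hj
  have hφl := hφ.isMode l hl
  have hgreen := hφl.depthIntegral_modeOperator_mul hW hX (k j X) hu.contDiffAt hu.bottom
  have hsource := depthIntegral_source_mul hI hW hφj hφl
    (fun x hx => hφ.pairing_eq_ite hW hj hl hx) (A j) hX Y
  have cφl := hφl.continuousOn_ofReal hX
  simp only [add_mul (W.modeOperator _ _ _ _ _)]
  rw [depthIntegral_add (hW.interface X hX)
    (fun s => (hW.continuousOn_modeOperator hX (k j X) hu.contDiffAt s).fun_mul (cφl s))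
    (fun s => (hW.continuousOn_source hφj (A j) hX Y s).fun_mul (cφl s)), hgreen, hu.jump_eq,
    hu.jump_flux_eq, coupling]
  linear_combination hsource

theorem IsModeFamily.depthIntegral_resonantPart_mul (hφ : W.IsModeFamily I J k φ)
    (hW : W.Regular I) (u : ℕ → Side → Expansion) (hl : l ∈ J) (hX : X ∈ I) (Y : ℝ) :
    W.depthIntegral (fun s z => W.resonantPart J ε θ k φ u s X Y z * φ l s X z) X
      = ∑ j ∈ J, ((k l X : ℂ) ^ 2 - (k j X : ℂ) ^ 2) * W.B φ u j l X Y
          * Complex.exp (Complex.I / ε * θ j X) := by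
  rw [← hφ.depthIntegral_sum_mul hW hl hX fun m => ∑ j ∈ J,
    ((k m X : ℂ) ^ 2 - (k j X : ℂ) ^ 2) * W.B φ u j m X Y * Complex.exp (Complex.I / ε * θ j X)]
  refine depthIntegral_congr (hW.interface X hX) fun s z _ => ?_
  simp only [resonantPart, Finset.sum_mul]
  rw [Finset.sum_comm]
  refine Finset.sum_congr rfl fun m _ => Finset.sum_congr rfl fun j _ => ?_
  ring

end ModeFamily

section Solvability

variable {W : Waveguide} {I : Set ℝ} {X : ℝ} {J : Finset ℕ} {ε : ℝ} {k : ℕ → ℝ → ℝ}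
  {φ : ℕ → Side → ℝ → ℝ → ℝ} {θ : ℕ → ℝ → ℝ} {A : ℕ → ℝ → ℝ → ℂ} {u : ℕ → Side → Expansion}
  {r : Side → Fld} {j l : ℕ}

theorem SolvesOrderOne.isTransmission (hu : W.SolvesOrderOne I J ε θ r u) (hW : W.Regular I)
    (hφ : W.IsModeFamily I J k φ) (hθ : ∀ j ∈ J, ∀ X ∈ I, HasDerivAt (θ j) (k j X) X)
    (hu₀ : HasLeadingTerm J φ A u) (hj : j ∈ J) (hX : X ∈ I) (Y : ℝ) :
    W.IsTransmission X (W.valueJump (φ j) (A j) X Y) (W.fluxJump (k j) (φ j) (A j) X Y)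
      (fun s => PowerSeries.coeff 1 (u j s) X Y) where
  contDiffAt s z hz := hu.smooth j hj s X hX Y z hz
  bottom := by simpa only [coeff_termwise, dZ] using hu.bottom j hj X hX Y
  jump_eq := (coeff_one_trace_eq_iff (hu₀ j hj)).1 (hu.interface j hj X hX Y)
  jump_flux_eq := (coeff_one_trace_flux_eq_iff hW (hφ.isMode j hj) hX (hθ j hj X hX)
    (hu₀ j hj)).1 (hu.interface_flux j hj X hX Y)

theorem SolvesOrderOne.depthIntegral_mul (hu : W.SolvesOrderOne I J ε θ r u) (hI : IsOpen I)
    (hW : W.Regular I) (hφ : W.IsModeFamily I J k φ)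
    (hθ : ∀ j ∈ J, ∀ X ∈ I, HasDerivAt (θ j) (k j X) X)
    (hA : ∀ j ∈ J, ∀ X ∈ I, ∀ Y, DifferentiableAt ℝ (fun t => A j t Y) X)
    (hu₀ : HasLeadingTerm J φ A u) (hl : l ∈ J) (hX : X ∈ I) (Y : ℝ) :
    W.depthIntegral (fun s z => r s X Y z * φ l s X z) X
      = (∑ j ∈ J, ((k l X : ℂ) ^ 2 - (k j X : ℂ) ^ 2) * W.B φ u j l X Y
          * Complex.exp (Complex.I / ε * θ j X))
        + W.mpe J ε θ k φ A l X Y * Complex.exp (Complex.I / ε * θ l X) := by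
  let L (j : ℕ) (s : Side) (z : ℝ) : ℂ :=
    W.modeOperator (k j X) X (fun s => PowerSeries.coeff 1 (u j s) X Y) s z
      + W.source (k j) (φ j) (A j) X Y s z
  have hproj (j : ℕ) (hj : j ∈ J) : W.depthIntegral (fun s z => L j s z * φ l s X z) X
      = ((k l X : ℂ) ^ 2 - (k j X : ℂ) ^ 2) * W.B φ u j l X Y + W.coupling k φ A l j X Y := by
    rw [hφ.depthIntegral_component_mul hI hW hj hl hX Y (hu.isTransmission hW hφ hθ hu₀ hj hX Y),
      hu.surface j hj X hX Y, zero_mul, sub_zero]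
    rfl
  have hcont (j : ℕ) (hj : j ∈ J) (s : Side) : ContinuousOn (fun z =>
      Complex.exp (Complex.I / ε * θ j X) * (L j s z * φ l s X z)) (W.layer s X) :=
    continuousOn_const.mul (((hW.continuousOn_modeOperator hX (k j X)
      (fun s z hz => hu.smooth j hj s X hX Y z hz) s).add
      (hW.continuousOn_source (hφ.isMode j hj) (A j) hX Y s)).mul
      ((hφ.isMode l hl).continuousOn_ofReal hX s))
  have hequation (s : Side) (z : ℝ) (hz : z ∈ W.openLayer s X) : r s X Y z * φ l s X z
      = ∑ j ∈ J, Complex.exp (Complex.I / ε * θ j X) * (L j s z * φ l s X z) := by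
    have hz' := openLayer_subset_layer s hz
    rw [← hu.equation s X hX Y z hz, Finset.sum_mul]
    refine Finset.sum_congr rfl fun j hj => ?_
    rw [coeff_one_helmholtz_of_leadingTerm hI hW (hφ.isMode j hj) (hθ j hj) hX (hA j hj X hX Y)
      (hu₀ j hj s) hz' (hu.smooth j hj s X hX Y z hz'), mul_comm _ (Complex.exp _), mul_assoc]
  rw [depthIntegral_congr (hW.interface X hX) hequation,
    depthIntegral_sum (hW.interface X hX) J hcont, ← sum_coupling_mul_exp hl,
    ← Finset.sum_add_distrib]
  refine Finset.sum_congr rfl fun j hj => ?_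
  rw [depthIntegral_const_mul, hproj j hj]
  ring

theorem IsModeFamily.sq_sub_sq_mul_pairing (hφ : W.IsModeFamily I J k φ) (hI : IsOpen I)
    (hW : W.Regular I) (hj : j ∈ J) (hl : l ∈ J) (hX : X ∈ I) {Y : ℝ} {v : Side → ℝ → ℂ}
    (hv : W.IsTransmission X (W.valueJump (φ j) (A j) X Y) (W.fluxJump (k j) (φ j) (A j) X Y) v)
    (heq : ∀ s, ∀ z ∈ W.layer s X,
      W.modeOperator (k j X) X v s z + W.source (k j) (φ j) (A j) X Y s z
        = ∑ m ∈ J, W.coupling k φ A m j X Y * (W.γ₀ s X z * φ m s X z)) :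
    ((k l X : ℂ) ^ 2 - (k j X : ℂ) ^ 2) * W.pairing X v (fun s z => φ l s X z)
      = v .above 0 * ((W.γ₀ .above X 0 * deriv (φ l .above X) 0 : ℝ) : ℂ) := by
  have hproj := hφ.depthIntegral_component_mul hI hW hj hl hX Y hv
  rw [depthIntegral_congr (hW.interface X hX) fun s z hz => by
      rw [heq s z (openLayer_subset_layer s hz)],
    hφ.depthIntegral_sum_mul hW hl hX fun m => W.coupling k φ A m j X Y] at hproj
  linear_combination -hproj

/-- A solution of the `j`-th component of the problem at order `ε` with right-hand side in the span
of the `γ₀ φ_m`, the coefficients being those for which its resonant terms vanish. -/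
structure IsNonresonantComponent (W : Waveguide) (J : Finset ℕ) (k : ℕ → ℝ → ℝ)
    (φ : ℕ → Side → ℝ → ℝ → ℝ) (A : ℕ → ℝ → ℝ → ℂ) (j : ℕ) (X Y : ℝ) (v : Side → ℝ → ℂ) : Prop
    extends W.IsTransmission X (W.valueJump (φ j) (A j) X Y) (W.fluxJump (k j) (φ j) (A j) X Y) v
    where
  surface : v .above 0 = 0
  equation : ∀ s, ∀ z ∈ W.layer s X,
    W.modeOperator (k j X) X v s z + W.source (k j) (φ j) (A j) X Y s z
      = ∑ m ∈ J, W.coupling k φ A m j X Y * (W.γ₀ s X z * φ m s X z)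

theorem IsModeFamily.exists_isNonresonantComponent (hφ : W.IsModeFamily I J k φ) (hI : IsOpen I)
    (hW : W.Regular I) (A : ℕ → ℝ → ℝ → ℂ) (hj : j ∈ J) (hX : X ∈ I) (Y : ℝ) :
    ∃ v, W.IsNonresonantComponent J k φ A j X Y v := by
  have hφj := hφ.isMode j hj
  have hrhs (s : Side) : ContinuousOn (fun z =>
      (∑ m ∈ J, W.coupling k φ A m j X Y * ((W.γ₀ s X z : ℂ) * φ m s X z))
        - W.source (k j) (φ j) (A j) X Y s z) (W.layer s X) :=
    (continuousOn_finsetSum _ fun m hm => continuousOn_const.mul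
      ((hW.continuousOn_γ₀ hX s).mul ((hφ.isMode m hm).continuousOn_ofReal hX s))).sub
      (hW.continuousOn_source hφj (A j) hX Y s)
  obtain ⟨v, hv, heq⟩ := exists_isTransmission_modeOperator_eq hW hX (k j X) hrhs
    (W.valueJump (φ j) (A j) X Y) (W.fluxJump (k j) (φ j) (A j) X Y)
  have hequation := fun s z hz => eq_sub_iff_add_eq.1 (heq s z hz)
  have hgreen := hφ.sq_sub_sq_mul_pairing hI hW hj hj hX hv hequation
  rw [sub_self, zero_mul, eq_comm, mul_eq_zero, Complex.ofReal_eq_zero] at hgreen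
  have hflux : W.γ₀ .above X 0 * deriv (φ j .above X) 0 ≠ 0 :=
    mul_ne_zero (hW.pos_γ₀ .above X hX 0 (surface_mem_layer (hW.interface X hX))).ne'
      (hφj.deriv_surface_ne_zero hW hX)
  exact ⟨v, hv, hgreen.resolve_right hflux, hequation⟩

theorem resonantPart_eq_zero (hI : IsOpen I) (hW : W.Regular I) (hφ : W.IsModeFamily I J k φ)
    (hX : X ∈ I) {Y : ℝ} (hu : ∀ j ∈ J,
      W.IsNonresonantComponent J k φ A j X Y fun s => PowerSeries.coeff 1 (u j s) X Y)
    (s : Side) (z : ℝ) : W.resonantPart J ε θ k φ u s X Y z = 0 := by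
  refine Finset.sum_eq_zero fun j hj => ?_
  rw [Finset.sum_eq_zero fun l hl => ?_, zero_mul]
  have hB : ((k l X : ℂ) ^ 2 - (k j X : ℂ) ^ 2) * W.B φ u j l X Y = 0 := by
    have hgreen := hφ.sq_sub_sq_mul_pairing hI hW hj hl hX (hu j hj).toIsTransmission
      (hu j hj).equation
    rwa [(hu j hj).surface, zero_mul] at hgreen
  rw [hB, zero_mul, zero_mul]

theorem sum_coeff_one_helmholtz_mul_exp (hI : IsOpen I) (hW : W.Regular I)
    (hφ : W.IsModeFamily I J k φ) (hθ : ∀ j ∈ J, ∀ X ∈ I, HasDerivAt (θ j) (k j X) X)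
    (hX : X ∈ I) {Y : ℝ} (hA : ∀ j ∈ J, DifferentiableAt ℝ (fun t => A j t Y) X)
    (hu₀ : HasLeadingTerm J φ A u) (hu : ∀ j ∈ J,
      W.IsNonresonantComponent J k φ A j X Y fun s => PowerSeries.coeff 1 (u j s) X Y)
    {s : Side} {z : ℝ} (hz : z ∈ W.layer s X) :
    ∑ j ∈ J, PowerSeries.coeff 1 (helmholtz (W.γ s) (W.κsq s) (θ j) (u j s)) X Y z
        * Complex.exp (Complex.I / ε * θ j X)
      = ∑ l ∈ J, W.mpe J ε θ k φ A l X Y * Complex.exp (Complex.I / ε * θ l X)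
          * (W.γ₀ s X z * φ l s X z) := by
  calc ∑ j ∈ J, PowerSeries.coeff 1 (helmholtz (W.γ s) (W.κsq s) (θ j) (u j s)) X Y z
        * Complex.exp (Complex.I / ε * θ j X)
    _ = ∑ j ∈ J, ∑ l ∈ J, W.coupling k φ A l j X Y * Complex.exp (Complex.I / ε * θ j X)
          * (W.γ₀ s X z * φ l s X z) := by
      refine Finset.sum_congr rfl fun j hj => ?_
      rw [coeff_one_helmholtz_of_leadingTerm hI hW (hφ.isMode j hj) (hθ j hj) hX (hA j hj)
        (hu₀ j hj s) hz ((hu j hj).contDiffAt s z hz), (hu j hj).equation s z hz, Finset.sum_mul]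
      exact Finset.sum_congr rfl fun l _ => mul_right_comm _ _ _
    _ = ∑ l ∈ J, W.mpe J ε θ k φ A l X Y * Complex.exp (Complex.I / ε * θ l X)
          * (W.γ₀ s X z * φ l s X z) := by
      rw [Finset.sum_comm]
      exact Finset.sum_congr rfl fun l hl => by rw [← Finset.sum_mul, sum_coupling_mul_exp hl]

theorem exists_coeff_zero_eq_coeff_one_eq (f g : Fld) :
    ∃ u : Expansion, PowerSeries.coeff 0 u = f ∧ PowerSeries.coeff 1 u = g :=
  ⟨PowerSeries.mk fun n => if n = 0 then f else g, by simp, by simp⟩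

theorem IsModeFamily.exists_solvesOrderOne (hφ : W.IsModeFamily I J k φ) (hI : IsOpen I)
    (hW : W.Regular I) (hθ : ∀ j ∈ J, ∀ X ∈ I, HasDerivAt (θ j) (k j X) X)
    (hA : ∀ j ∈ J, ∀ X ∈ I, ∀ Y, DifferentiableAt ℝ (fun t => A j t Y) X)
    (hmpe : ∀ l ∈ J, ∀ X ∈ I, ∀ Y, W.mpe J ε θ k φ A l X Y = 0) :
    ∃ u, HasLeadingTerm J φ A u ∧ W.SolvesOrderOne I J ε θ (W.resonantPart J ε θ k φ u) u := by
  choose! v hv using fun j (hj : j ∈ J) X (hX : X ∈ I) =>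
    hφ.exists_isNonresonantComponent hI hW A hj hX
  choose u hu₀ hu₁ using fun j s => exists_coeff_zero_eq_coeff_one_eq
    (fun X Y z => A j X Y * φ j s X z) (fun X Y z => v j X Y s z)
  have hu : ∀ j ∈ J, ∀ X ∈ I, ∀ Y,
      W.IsNonresonantComponent J k φ A j X Y fun s => PowerSeries.coeff 1 (u j s) X Y := by
    simpa only [hu₁] using hv
  refine ⟨u, fun j _ => hu₀ j, fun j hj s X hX Y => (hu j hj X hX Y).contDiffAt s, ?_,
    fun j hj X hX Y => (hu j hj X hX Y).surface, ?_, ?_, ?_⟩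
  · intro s X hX Y z hz
    rw [sum_coeff_one_helmholtz_mul_exp hI hW hφ hθ hX (fun j hj => hA j hj X hX Y)
        (fun j _ => hu₀ j) (fun j hj => hu j hj X hX Y) (openLayer_subset_layer s hz),
      resonantPart_eq_zero hI hW hφ hX fun j hj => hu j hj X hX Y]
    exact Finset.sum_eq_zero fun l hl => by rw [hmpe l hl X hX Y, zero_mul, zero_mul]
  · intro j hj X hX Y
    simpa only [coeff_termwise, dZ] using (hu j hj X hX Y).bottom
  · exact fun j hj X hX Y => (coeff_one_trace_eq_iff (hu₀ j)).2 (hu j hj X hX Y).jump_eq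
  · exact fun j hj X hX Y => (coeff_one_trace_flux_eq_iff hW (hφ.isMode j hj) hX
      (hθ j hj X hX) (hu₀ j)).2 (hu j hj X hX Y).jump_flux_eq

theorem SolvesOrderOne.mpe_eq_zero (hu : W.SolvesOrderOne I J ε θ (W.resonantPart J ε θ k φ u) u)
    (hI : IsOpen I) (hW : W.Regular I) (hφ : W.IsModeFamily I J k φ)
    (hθ : ∀ j ∈ J, ∀ X ∈ I, HasDerivAt (θ j) (k j X) X)
    (hA : ∀ j ∈ J, ∀ X ∈ I, ∀ Y, DifferentiableAt ℝ (fun t => A j t Y) X)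
    (hu₀ : HasLeadingTerm J φ A u) (hl : l ∈ J) (hX : X ∈ I) (Y : ℝ) :
    W.mpe J ε θ k φ A l X Y = 0 := by
  have hproj := hu.depthIntegral_mul hI hW hφ hθ hA hu₀ hl hX Y
  rw [hφ.depthIntegral_resonantPart_mul hW u hl hX Y, left_eq_add] at hproj
  exact (mul_eq_zero.1 hproj).resolve_right (Complex.exp_ne_zero _)

theorem SolvesOrderOne.mpe_eq (hu : W.SolvesOrderOne I J ε θ 0 u) (hI : IsOpen I)
    (hW : W.Regular I) (hφ : W.IsModeFamily I J k φ)
    (hθ : ∀ j ∈ J, ∀ X ∈ I, HasDerivAt (θ j) (k j X) X)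
    (hA : ∀ j ∈ J, ∀ X ∈ I, ∀ Y, DifferentiableAt ℝ (fun t => A j t Y) X)
    (hu₀ : HasLeadingTerm J φ A u) (hl : l ∈ J) (hX : X ∈ I) (Y : ℝ) :
    W.mpe J ε θ k φ A l X Y
      = -∑ j ∈ J.erase l, ((k l X : ℂ) ^ 2 - (k j X : ℂ) ^ 2) * W.B φ u j l X Y
          * Complex.exp (Complex.I / ε * (θ j X - θ l X)) := by
  have hproj := hu.depthIntegral_mul hI hW hφ hθ hA hu₀ hl hX Y
  have hzero : W.depthIntegral (fun s z => (0 : Side → Fld) s X Y z * φ l s X z) X = 0 := by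
    simp [depthIntegral]
  rw [hzero, ← Finset.add_sum_erase _ _ hl, sub_self, zero_mul, zero_mul, zero_add] at hproj
  refine mul_right_cancel₀ (Complex.exp_ne_zero (Complex.I / ε * θ l X)) ?_
  rw [neg_mul, Finset.sum_mul, eq_neg_iff_add_eq_zero, add_comm, hproj]
  simp only [mul_assoc, exp_phase_sub_mul]

theorem norm_sum_resonant_le (hφ : W.IsModeFamily I J k φ) (hX : X ∈ I) (hl : l ∈ J)
    (hresonant : ∀ j ∈ J, |k l X - k j X| ≤ ε) (b : ℕ → ℂ) :
    ‖∑ j ∈ J.erase l, ((k l X : ℂ) ^ 2 - (k j X : ℂ) ^ 2) * b j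
        * Complex.exp (Complex.I / ε * (θ j X - θ l X))‖
      ≤ ε * ∑ j ∈ J.erase l, (k l X + k j X) * ‖b j‖ := by
  rw [Finset.mul_sum]
  refine norm_sum_le_of_le _ fun j hj => ?_
  have hjJ := Finset.mem_of_mem_erase hj
  rw [norm_mul, norm_mul, norm_exp_phase, mul_one, ← mul_assoc]
  gcongr
  exact norm_sq_sub_sq_le (add_pos ((hφ.isMode l hl).pos X hX) ((hφ.isMode j hjJ).pos X hX)).le
    (hresonant j hjJ)

end Solvability

end Waveguide

end

theorem proposition1 (W : Waveguide) (I : Set ℝ) (hI : IsOpen I) (hW : W.Regular I)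
    (M N : ℕ) (ε : ℝ) (hε : 0 < ε)
    (k : ℕ → ℝ → ℝ) (φ : ℕ → Side → ℝ → ℝ → ℝ)
    (hmode : ∀ j ∈ Finset.Icc M N, W.IsMode I (k j) (φ j))
    (hdistinct : ∀ X ∈ I, ∀ j ∈ Finset.Icc M N, ∀ l ∈ Finset.Icc M N, k j X = k l X → j = l)
    (hresonant : ∀ X ∈ I, ∀ j ∈ Finset.Icc M N, ∀ l ∈ Finset.Icc M N, |k l X - k j X| < ε)
    (θ : ℕ → ℝ → ℝ) (hθ : ∀ j ∈ Finset.Icc M N, ∀ X ∈ I, HasDerivAt (θ j) (k j X) X)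
    (A : ℕ → ℝ → ℝ → ℂ)
    (hAX : ∀ j ∈ Finset.Icc M N, ∀ X ∈ I, ∀ Y, DifferentiableAt ℝ (fun t => A j t Y) X)
    (hAY : ∀ j ∈ Finset.Icc M N, ∀ X ∈ I, ContDiff ℝ 2 (A j X)) :
    -- every solution of the problem at order `ε` satisfies the mode parabolic equations
    -- up to the resonant terms, which are `O(ε)`
    (∀ u : ℕ → Side → Expansion, Waveguide.HasLeadingTerm (Finset.Icc M N) φ A u →
      W.SolvesOrderOne I (Finset.Icc M N) ε θ 0 u →
      ∀ l ∈ Finset.Icc M N, ∀ X ∈ I, ∀ Y : ℝ,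
        W.mpe (Finset.Icc M N) ε θ k φ A l X Y
          = - ∑ j ∈ (Finset.Icc M N).erase l, ((k l X : ℂ) ^ 2 - (k j X : ℂ) ^ 2)
              * W.B φ u j l X Y * Complex.exp (Complex.I / ε * (θ j X - θ l X)) ∧
        ‖W.mpe (Finset.Icc M N) ε θ k φ A l X Y‖
          ≤ ε * ∑ j ∈ (Finset.Icc M N).erase l, (k l X + k j X) * ‖W.B φ u j l X Y‖) ∧
    -- with the resonant terms omitted, the problem at order `ε` is solvable
    -- if and only if the mode parabolic equations hold
    ((∃ u : ℕ → Side → Expansion, Waveguide.HasLeadingTerm (Finset.Icc M N) φ A u ∧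
        W.SolvesOrderOne I (Finset.Icc M N) ε θ
          (W.resonantPart (Finset.Icc M N) ε θ k φ u) u) ↔
      ∀ l ∈ Finset.Icc M N, ∀ X ∈ I, ∀ Y : ℝ,
        W.mpe (Finset.Icc M N) ε θ k φ A l X Y = 0) := by
  have hφ : W.IsModeFamily I (Finset.Icc M N) k φ := ⟨hmode, hdistinct⟩
  refine ⟨fun u hu₀ hu l hl X hX Y => ?_, ?_, ?_⟩
  · have hmpe := hu.mpe_eq hI hW hφ hθ hAX hu₀ hl hX Y
    refine ⟨hmpe, ?_⟩
    rw [hmpe, norm_neg]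
    exact Waveguide.norm_sum_resonant_le hφ hX hl (fun j hj => (hresonant X hX j hj l hl).le) _
  · rintro ⟨u, hu₀, hu⟩ l hl X hX Y
    exact hu.mpe_eq_zero hI hW hφ hθ hAX hu₀ hl hX Y
  · exact hφ.exists_solvesOrderOne hI hW hθ hAX
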